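/- Let $0<s<1$, let $N\ge 1$ be an integer with $N>2s$, let $\Omega\subset\mathbb{R}^N$ be an arbitrary bounded open set, and let $\frac{2N}{N+2s}\le p\le\infty$. All functions are real-valued and are identified when they agree almost everywhere. Let $W_0^{s,2}(\overline\Omega)$ be the space of all $u\in L^2(\mathbb{R}^N)$ with $\iint_{\mathbb{R}^N\times\mathbb{R}^N}\frac{|u(x)-u(y)|^2}{|x-y|^{N+2s}}\,dx\,dy<\infty$ and $u=0$ a.e. on $\mathbb{R}^N\setminus\Omega$, with the norm of $W^{s,2}(\mathbb{R}^N)$, let $W^{-s,2}(\overline\Omega)$ be its dual, and put $$\mathcal E(u,v)=\frac{C_{N,s}}{2}\int_{\mathbb{R}^N}\int_{\mathbb{R}^N}\frac{(u(x)-u(y))(v(x)-v(y))}{|x-y|^{N+2s}}\,dx\,dy,\qquad C_{N,s}=\frac{s2^{2s}\Gamma\left(\frac{2s+N}{2}\right)}{\pi^{N/2}\Gamma(1-s)}.$$ Consider the Dirichlet problem $$(-\Delta)^su=f\ \text{ in }\Omega,\qquad u=0\ \text{ on }\mathbb{R}^N\setminus\Omega. \tag{DP}$$ A finite energy solution of (DP),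 for a function $f$ on $\Omega$ that defines an element $v\mapsto\int_\Omega fv\,dx$ of $W^{-s,2}(\overline\Omega)$, is a function $u\in W_0^{s,2}(\overline\Omega)$ such that $\mathcal E(u,v)=\int_\Omega fv\,dx$ for every $v\in W_0^{s,2}(\overline\Omega)$. A duality solution of (DP), for $f\in L^1(\Omega)$, is a function $u\in L^1(\Omega)$ such that, for all $\psi\in C_0^\infty(\Omega)$ and every finite energy solution $\varphi$ of $(-\Delta)^s\varphi=\psi$ in $\Omega$, $\varphi=0$ on $\mathbb{R}^N\setminus\Omega$, the function $f\varphi$ is integrable on $\Omega$ and $\int_\Omega u\psi\,dx=\int_\Omega f\varphi\,dx$. For every $f\in L^p(\Omega)$, the problem (DP) has a unique finite energy solution and a unique duality solution, and the two coincide on $\Omega$; call it the weak solution $u$. Moreover: (a) If $p>\frac{N}{2s}$, then $u\in L^\infty(\Omega)$, and there is a constant $C>0$, independent of $f$, such that $\|u\|_{L^\infty(\Omega)}\le C\|f\|_{L^p(\Omega)}$ for every $f\in L^p(\Omega)$. (b) If $\frac{2N}{N+2s}\le p\le\frac{N}{2s}$, then $u\in L^q(\Omega)$ for every $q$ with $p\le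 q<\frac{Np}{N-2sp}$ (that is, $p\le q<\infty$ when $p=\frac{N}{2s}$), and for each such $q$ there is a constant $C>0$, independent of $f$, such that $\|u\|_{L^q(\Omega)}\le C\|f\|_{L^p(\Omega)}$ for every $f\in L^p(\Omega)$. -/

import Mathlib

open MeasureTheory
open scoped ENNReal ContDiff

noncomputable section

namespace FracDirichlet

/-- The normalization constant
`C_{N,s} = s 2^{2s} Γ((2s+N)/2) / (π^{N/2} Γ(1-s))` of the fractional Laplacian. -/
def normConst (N : ℕ) (s : ℝ) : ℝ :=
  s * (2 : ℝ) ^ (2 * s) * Real.Gamma ((2 * s + N) / 2) /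
    (Real.pi ^ ((N : ℝ) / 2) * Real.Gamma (1 - s))

variable {N : ℕ}

/-- The function `(u(x)-u(y)) (v(x)-v(y)) / |x-y|^{N+2s}` on `ℝ^N × ℝ^N`. -/
def gagliardoKernel (s : ℝ) (u v : EuclideanSpace ℝ (Fin N) → ℝ)
    (z : EuclideanSpace ℝ (Fin N) × EuclideanSpace ℝ (Fin N)) : ℝ :=
  (u z.1 - u z.2) * (v z.1 - v z.2) / ‖z.1 - z.2‖ ^ ((N : ℝ) + 2 * s)

/-- The bilinear form
`E(u,v) = (C_{N,s}/2) ∫∫ (u(x)-u(y)) (v(x)-v(y)) / |x-y|^{N+2s} dx dy`. -/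
def energyForm (s : ℝ) (u v : EuclideanSpace ℝ (Fin N) → ℝ) : ℝ :=
  normConst N s / 2 * ∫ z, gagliardoKernel s u v z ∂(volume.prod volume)

/-- Representatives of the elements of `W^{s,2}(ℝ^N)`: functions in `L²(ℝ^N)` with
`∫∫ |u(x)-u(y)|² / |x-y|^{N+2s} dx dy < ∞`. -/
structure MemFracSobolev (s : ℝ) (u : EuclideanSpace ℝ (Fin N) → ℝ) : Prop where
  memLp : MemLp u 2 volume
  finite_seminorm : Integrable (gagliardoKernel s u u) (volume.prod volume)

/-- The norm of `W^{s,2}(ℝ^N)`. -/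
def fracSobolevNorm (s : ℝ) (u : EuclideanSpace ℝ (Fin N) → ℝ) : ℝ :=
  Real.sqrt ((∫ x, u x ^ 2) + ∫ z, gagliardoKernel s u u z ∂(volume.prod volume))

/-- The space `W_0^{s,2}(Ω̄)`: elements of `W^{s,2}(ℝ^N)` that are zero (almost everywhere)
on `ℝ^N ∖ Ω`. -/
structure MemFracSobolevZero (s : ℝ) (Ω : Set (EuclideanSpace ℝ (Fin N)))
    (u : EuclideanSpace ℝ (Fin N) → ℝ) : Prop where
  mem : MemFracSobolev s u
  zero_outside : ∀ᵐ x, x ∉ Ω → u x = 0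

/-- The function `f` on `Ω` belongs to `W^{-s,2}(Ω̄)`, the dual of `W_0^{s,2}(Ω̄)`, through the
pairing `⟨f, v⟩ = ∫_Ω f v dx`: the pairing is well defined, and it is a bounded (linear)
functional on `W_0^{s,2}(Ω̄)`. -/
def MemDual (s : ℝ) (Ω : Set (EuclideanSpace ℝ (Fin N)))
    (f : EuclideanSpace ℝ (Fin N) → ℝ) : Prop :=
  ∃ K : ℝ, ∀ v, MemFracSobolevZero s Ω v →
    IntegrableOn (fun x => f x * v x) Ω volume ∧
      |∫ x in Ω, f x * v x| ≤ K * fracSobolevNorm s v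

/-- `u` is a finite energy solution of `(-Δ)^s u = f` in `Ω`, `u = 0` on `ℝ^N ∖ Ω`. -/
structure IsFiniteEnergySolution (s : ℝ) (Ω : Set (EuclideanSpace ℝ (Fin N)))
    (f u : EuclideanSpace ℝ (Fin N) → ℝ) : Prop where
  datum_mem : MemDual s Ω f
  mem : MemFracSobolevZero s Ω u
  eq : ∀ v, MemFracSobolevZero s Ω v → energyForm s u v = ∫ x in Ω, f x * v x

/-- `ψ` belongs to `C_0^∞(Ω)`: smooth with compact support contained in `Ω`. -/
structure IsTestFunction (Ω : Set (EuclideanSpace ℝ (Fin N)))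
    (ψ : EuclideanSpace ℝ (Fin N) → ℝ) : Prop where
  smooth : ContDiff ℝ ∞ ψ
  compact : HasCompactSupport ψ
  support_subset : tsupport ψ ⊆ Ω

/-- `u` is a solution of `(-Δ)^s u = f` in `Ω`, `u = 0` on `ℝ^N ∖ Ω`, in the sense of
duality: `u, f ∈ L¹(Ω)` and `∫_Ω u ψ = ∫_Ω f φ` whenever `ψ ∈ C_0^∞(Ω)` and `φ` is the solution
of `(-Δ)^s φ = ψ` in `Ω`, `φ = 0` on `ℝ^N ∖ Ω`. -/
structure IsDualitySolution (s : ℝ) (Ω : Set (EuclideanSpace ℝ (Fin N)))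
    (f u : EuclideanSpace ℝ (Fin N) → ℝ) : Prop where
  integrable : IntegrableOn u Ω volume
  datum_integrable : IntegrableOn f Ω volume
  eq : ∀ φ ψ, IsTestFunction Ω ψ → IsFiniteEnergySolution s Ω ψ φ →
    IntegrableOn (fun x => f x * φ x) Ω volume ∧
      ∫ x in Ω, u x * ψ x = ∫ x in Ω, f x * φ x

/-- The exponent `N p / (N - 2 s p)` for `p < N / (2 s)`, read as `∞` for `p = N / (2 s)`
(it is only used for `p ≤ N / (2 s)`). -/
def limitExponent (N : ℕ) (s : ℝ) (p : ℝ≥0∞) : ℝ≥0∞ :=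
  if p < ENNReal.ofReal (N / (2 * s)) then
    ENNReal.ofReal (N * p.toReal / (N - 2 * s * p.toReal))
  else ∞

end FracDirichlet

end

open FracDirichlet

noncomputable section

namespace FracDirichlet

open Filter Topology

variable {N : ℕ}

/-! Everything rests on the fractional Sobolev inequality `eLpNorm_sobolevExp_le`, proved from
scratch. Compare `u x` with `u` on a ball of radius `r`, choose the best `r`, and integrate in `x`.
The inequality makes the Gagliardo seminorm a norm on `W_0^{s,2}(Ω̄)`. It also bounds `v ↦ ∫_Ω f v`
for `f` in `L^{2N/(N+2s)}`, and hence for `f` in `L^p` since `Ω` has finite measure.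

Sending `u` to its difference quotient identifies the energy space with a closed subspace of `L²(ℝ^N
× ℝ^N)`, where the energy is a multiple of the inner product. The Riesz theorem then gives a finite
energy solution. By symmetry of the energy it is a duality solution. Two duality solutions have the
same integral against every test function, so they agree.

Both regularity statements come from testing with `Φ(u)`. A pointwise inequality `(Ψ a - Ψ b)² ≤ κ
(a - b)(Φ a - Φ b)` plays the role of the chain rule, and with Sobolev it gives `‖Ψ(u)‖² ≤ C ∫_Ω f
Φ(u)` (`IsFiniteEnergySolution.sq_eLpNorm_comp_le`). Truncated powers give the `L^q` bound,
including the endpoint `Np/(N-2sp)`. The excess of `u` over a level `k` gives a decay estimate for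
the measures of the level sets, and Stampacchia's lemma turns this into an `L^∞` bound. Boundedness
of `Ω` gives the remaining exponents. -/

/-! ### Difference quotients and the energy space -/

/-- The difference quotient `(u(x)-u(y)) / |x-y|^{(N+2s)/2}`. -/
def diffQuot (s : ℝ) (u : EuclideanSpace ℝ (Fin N) → ℝ)
    (z : EuclideanSpace ℝ (Fin N) × EuclideanSpace ℝ (Fin N)) : ℝ :=
  (u z.1 - u z.2) / ‖z.1 - z.2‖ ^ (((N : ℝ) + 2 * s) / 2)

/-- The squared Gagliardo seminorm. -/
def gagliardoSq (s : ℝ) (u : EuclideanSpace ℝ (Fin N) → ℝ) : ℝ :=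
  ∫ z, gagliardoKernel s u u z ∂(volume.prod volume)

lemma gagliardoKernel_eq_mul_diffQuot (s : ℝ) (u v : EuclideanSpace ℝ (Fin N) → ℝ)
    (z : EuclideanSpace ℝ (Fin N) × EuclideanSpace ℝ (Fin N)) :
    gagliardoKernel s u v z = diffQuot s u z * diffQuot s v z := by
  have h : ‖z.1 - z.2‖ ^ ((N : ℝ) + 2 * s) =
      ‖z.1 - z.2‖ ^ (((N : ℝ) + 2 * s) / 2) * ‖z.1 - z.2‖ ^ (((N : ℝ) + 2 * s) / 2) := by
    rw [← pow_two, ← Real.rpow_natCast, ← Real.rpow_mul (norm_nonneg _)]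
    congr 1
    push_cast
    ring
  rw [gagliardoKernel, diffQuot, diffQuot, h, div_mul_div_comm]

lemma gagliardoKernel_self_nonneg (s : ℝ) (u : EuclideanSpace ℝ (Fin N) → ℝ)
    (z : EuclideanSpace ℝ (Fin N) × EuclideanSpace ℝ (Fin N)) :
    0 ≤ gagliardoKernel s u u z := by
  rw [gagliardoKernel_eq_mul_diffQuot]
  exact mul_self_nonneg _

lemma gagliardoSq_nonneg (s : ℝ) (u : EuclideanSpace ℝ (Fin N) → ℝ) : 0 ≤ gagliardoSq s u :=
  integral_nonneg (gagliardoKernel_self_nonneg s u)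

lemma aestronglyMeasurable_diffQuot (s : ℝ) {u : EuclideanSpace ℝ (Fin N) → ℝ}
    (hu : AEStronglyMeasurable u volume) :
    AEStronglyMeasurable (diffQuot s u) (volume.prod volume) := by
  have h1 : AEMeasurable (fun z : EuclideanSpace ℝ (Fin N) × EuclideanSpace ℝ (Fin N) =>
      u z.1 - u z.2) (volume.prod volume) :=
    (hu.comp_fst.sub hu.comp_snd).aemeasurable
  have h2 : Measurable (fun z : EuclideanSpace ℝ (Fin N) × EuclideanSpace ℝ (Fin N) =>
      ‖z.1 - z.2‖ ^ (((N : ℝ) + 2 * s) / 2)) := by fun_prop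
  exact (h1.div h2.aemeasurable).aestronglyMeasurable

lemma integrable_gagliardoKernel_iff (s : ℝ) {u : EuclideanSpace ℝ (Fin N) → ℝ}
    (hu : AEStronglyMeasurable u volume) :
    Integrable (gagliardoKernel s u u) (volume.prod volume) ↔
      MemLp (diffQuot s u) 2 (volume.prod volume) := by
  rw [memLp_two_iff_integrable_sq (aestronglyMeasurable_diffQuot s hu)]
  have : gagliardoKernel s u u = fun z => diffQuot s u z ^ 2 := by
    funext z
    rw [gagliardoKernel_eq_mul_diffQuot, sq]
  rw [this]

lemma diffQuot_add (s : ℝ) (u v : EuclideanSpace ℝ (Fin N) → ℝ) :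
    diffQuot s (u + v) = diffQuot s u + diffQuot s v := by
  funext z
  simp only [diffQuot, Pi.add_apply]
  ring

lemma diffQuot_smul (s c : ℝ) (u : EuclideanSpace ℝ (Fin N) → ℝ) :
    diffQuot s (c • u) = c • diffQuot s u := by
  funext z
  simp only [diffQuot, Pi.smul_apply, smul_eq_mul]
  ring

lemma diffQuot_sub (s : ℝ) (u v : EuclideanSpace ℝ (Fin N) → ℝ) :
    diffQuot s (u - v) = diffQuot s u - diffQuot s v := by
  funext z
  simp only [diffQuot, Pi.sub_apply]
  ring

lemma MemFracSobolev.memLp_diffQuot {s : ℝ} {u : EuclideanSpace ℝ (Fin N) → ℝ}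
    (hu : MemFracSobolev s u) : MemLp (diffQuot s u) 2 (volume.prod volume) :=
  (integrable_gagliardoKernel_iff s hu.memLp.1).1 hu.finite_seminorm

lemma MemFracSobolev.of_diffQuot {s : ℝ} {u : EuclideanSpace ℝ (Fin N) → ℝ}
    (hu : MemLp u 2 volume) (h : MemLp (diffQuot s u) 2 (volume.prod volume)) :
    MemFracSobolev s u :=
  ⟨hu, (integrable_gagliardoKernel_iff s hu.1).2 h⟩

lemma MemFracSobolev.integrable_gagliardoKernel {s : ℝ} {u v : EuclideanSpace ℝ (Fin N) → ℝ}
    (hu : MemFracSobolev s u) (hv : MemFracSobolev s v) :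
    Integrable (gagliardoKernel s u v) (volume.prod volume) := by
  have h : gagliardoKernel s u v = diffQuot s u * diffQuot s v := by
    funext z
    exact gagliardoKernel_eq_mul_diffQuot s u v z
  rw [h]
  exact MemLp.integrable_mul (p := 2) (q := 2) hu.memLp_diffQuot hv.memLp_diffQuot

lemma MemFracSobolevZero.zero (s : ℝ) (Ω : Set (EuclideanSpace ℝ (Fin N))) :
    MemFracSobolevZero s Ω 0 := by
  refine ⟨.of_diffQuot MemLp.zero' ?_, by simp⟩
  have : diffQuot s (0 : EuclideanSpace ℝ (Fin N) → ℝ) = 0 := by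
    funext z
    simp [diffQuot]
  rw [this]
  exact MemLp.zero'

lemma MemFracSobolevZero.add {s : ℝ} {Ω : Set (EuclideanSpace ℝ (Fin N))}
    {u v : EuclideanSpace ℝ (Fin N) → ℝ} (hu : MemFracSobolevZero s Ω u)
    (hv : MemFracSobolevZero s Ω v) : MemFracSobolevZero s Ω (u + v) := by
  refine ⟨.of_diffQuot (hu.mem.memLp.add hv.mem.memLp) ?_, ?_⟩
  · rw [diffQuot_add]
    exact hu.mem.memLp_diffQuot.add hv.mem.memLp_diffQuot
  · filter_upwards [hu.zero_outside, hv.zero_outside] with x h1 h2 hx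
    simp [h1 hx, h2 hx]

lemma MemFracSobolevZero.smul {s : ℝ} {Ω : Set (EuclideanSpace ℝ (Fin N))}
    {u : EuclideanSpace ℝ (Fin N) → ℝ} (hu : MemFracSobolevZero s Ω u) (c : ℝ) :
    MemFracSobolevZero s Ω (c • u) := by
  refine ⟨.of_diffQuot (hu.mem.memLp.const_smul c) ?_, ?_⟩
  · rw [diffQuot_smul]
    exact hu.mem.memLp_diffQuot.const_smul c
  · filter_upwards [hu.zero_outside] with x h1 hx
    simp [h1 hx]

lemma MemFracSobolevZero.sub {s : ℝ} {Ω : Set (EuclideanSpace ℝ (Fin N))}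
    {u v : EuclideanSpace ℝ (Fin N) → ℝ} (hu : MemFracSobolevZero s Ω u)
    (hv : MemFracSobolevZero s Ω v) : MemFracSobolevZero s Ω (u - v) := by
  have : u - v = u + (-1 : ℝ) • v := by
    funext x
    simp [sub_eq_add_neg]
  rw [this]
  exact hu.add (hv.smul _)

lemma MemFracSobolev.comp_lipschitz {s : ℝ} {u : EuclideanSpace ℝ (Fin N) → ℝ}
    (hu : MemFracSobolev s u) {Φ : ℝ → ℝ} {K : NNReal} (hΦ : LipschitzWith K Φ)
    (h0 : Φ 0 = 0) : MemFracSobolev s (Φ ∘ u) := by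
  have hL : MemLp (Φ ∘ u) 2 volume := hΦ.comp_memLp h0 hu.memLp
  refine .of_diffQuot hL ?_
  refine hu.memLp_diffQuot.of_le_mul (c := K) (aestronglyMeasurable_diffQuot s hL.1) ?_
  refine Eventually.of_forall fun z => ?_
  simp only [diffQuot, norm_div, Function.comp_apply]
  rw [← mul_div_assoc]
  gcongr
  exact hΦ.norm_sub_le _ _

lemma MemFracSobolevZero.comp_lipschitz {s : ℝ} {Ω : Set (EuclideanSpace ℝ (Fin N))}
    {u : EuclideanSpace ℝ (Fin N) → ℝ}
    (hu : MemFracSobolevZero s Ω u) {Φ : ℝ → ℝ} {K : NNReal} (hΦ : LipschitzWith K Φ)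
    (h0 : Φ 0 = 0) : MemFracSobolevZero s Ω (Φ ∘ u) := by
  refine ⟨hu.mem.comp_lipschitz hΦ h0, ?_⟩
  filter_upwards [hu.zero_outside] with x hx hxΩ
  simp [hx hxΩ, h0]

/-- Nonlocal substitute for the chain rule: the numerical hypothesis, applied with `a = u x`, `b = u
y` and divided by the positive weight, compares the two kernels pointwise. -/
lemma gagliardoSq_comp_le {s κ : ℝ} {u : EuclideanSpace ℝ (Fin N) → ℝ} {Φ Ψ : ℝ → ℝ}
    {K L : NNReal} (hu : MemFracSobolev s u) (hΦ : LipschitzWith K Φ) (hΦ0 : Φ 0 = 0)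
    (hΨ : LipschitzWith L Ψ) (hΨ0 : Ψ 0 = 0)
    (h : ∀ a b, (Ψ a - Ψ b) ^ 2 ≤ κ * ((a - b) * (Φ a - Φ b))) :
    gagliardoSq s (Ψ ∘ u) ≤
      κ * ∫ z, gagliardoKernel s u (Φ ∘ u) z ∂(volume.prod volume) := by
  rw [← integral_const_mul]
  refine integral_mono (hu.comp_lipschitz hΨ hΨ0).finite_seminorm
    ((hu.integrable_gagliardoKernel (hu.comp_lipschitz hΦ hΦ0)).const_mul κ) fun z => ?_
  simp only [gagliardoKernel, Function.comp_apply]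
  rw [← mul_div_assoc, ← sq]
  exact div_le_div_of_nonneg_right (h _ _) (by positivity)

lemma normConst_pos {s : ℝ} (hs0 : 0 < s) (hs1 : s < 1) (N : ℕ) : 0 < normConst N s := by
  unfold normConst
  have h1 : 0 < Real.Gamma ((2 * s + N) / 2) := Real.Gamma_pos_of_pos (by positivity)
  have h2 : 0 < Real.Gamma (1 - s) := Real.Gamma_pos_of_pos (by linarith)
  have := Real.pi_pos
  positivity

lemma eLpNorm_diffQuot {s : ℝ} {u : EuclideanSpace ℝ (Fin N) → ℝ} (hu : MemFracSobolev s u) :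
    eLpNorm (diffQuot s u) 2 (volume.prod volume) =
      ENNReal.ofReal (Real.sqrt (gagliardoSq s u)) := by
  rw [hu.memLp_diffQuot.eLpNorm_eq_integral_rpow_norm two_ne_zero ENNReal.ofNat_ne_top,
    Real.sqrt_eq_rpow]
  congr 2
  · refine integral_congr_ae (Eventually.of_forall fun z => ?_)
    simp [gagliardoKernel_eq_mul_diffQuot, sq]
  · norm_num

/-! ### Truncations -/

/-- Truncation at height `k`. -/
def trunc (k t : ℝ) : ℝ := max (-k) (min k t)

lemma lipschitzWith_trunc (k : ℝ) : LipschitzWith 1 (trunc k) :=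
  (LipschitzWith.id.const_min k).const_max (-k)

lemma trunc_zero {k : ℝ} (hk : 0 ≤ k) : trunc k 0 = 0 := by
  simp [trunc, hk]

lemma trunc_eq_self {k t : ℝ} (h : |t| ≤ k) : trunc k t = t := by
  rw [abs_le] at h
  simp [trunc, h.1, h.2]

lemma abs_trunc_le {k : ℝ} (hk : 0 ≤ k) (t : ℝ) : |trunc k t| ≤ k := by
  rw [abs_le]
  exact ⟨le_max_left _ _, max_le (by linarith) (min_le_left _ _)⟩

lemma monotone_trunc (k : ℝ) : Monotone (trunc k) := fun a b h => by
  unfold trunc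
  gcongr

lemma tendsto_trunc (t : ℝ) : Tendsto (fun n : ℕ => trunc n t) atTop (𝓝 t) := by
  refine tendsto_const_nhds.congr' ?_
  obtain ⟨n, hn⟩ := exists_nat_ge |t|
  filter_upwards [eventually_ge_atTop n] with m hm
  rw [trunc_eq_self]
  exact hn.trans (by exact_mod_cast hm)

/-- A uniform `L^q` bound on the truncations of `u` is a bound on `u`. -/
lemma eLpNorm_le_of_trunc {α : Type*} [MeasurableSpace α] {μ : Measure α} {u : α → ℝ}
    (hu : AEStronglyMeasurable u μ) {q B : ℝ≥0∞}
    (h : ∀ n : ℕ, eLpNorm (trunc n ∘ u) q μ ≤ B) : eLpNorm u q μ ≤ B := by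
  refine (Lp.eLpNorm_lim_le_liminf_eLpNorm (f := fun n : ℕ => trunc n ∘ u)
    (fun n => (lipschitzWith_trunc n).continuous.comp_aestronglyMeasurable hu) u
    (Eventually.of_forall fun x => tendsto_trunc (u x))).trans ?_
  refine (liminf_le_liminf (Eventually.of_forall h)).trans ?_
  simp

/-! ### The fractional Sobolev inequality -/

/-- The critical Sobolev exponent `2N / (N - 2s)`. -/
def sobolevExp (N : ℕ) (s : ℝ) : ℝ := 2 * N / (N - 2 * s)

lemma sobolevExp_pos {s : ℝ} (hs0 : 0 < s) (hN : 2 * s < (N : ℝ)) : 0 < sobolevExp N s := by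
  have : 0 < (N : ℝ) := by linarith
  exact div_pos (by linarith) (by linarith)

lemma two_lt_sobolevExp {s : ℝ} (hs0 : 0 < s) (hN : 2 * s < (N : ℝ)) : 2 < sobolevExp N s := by
  unfold sobolevExp
  rw [lt_div_iff₀ (by linarith)]
  linarith

/-- Optimisation over the radius. One term grows with `r` and the other decays, so the best radius
balances them; if `d = 0`, letting `r → ∞` forces `a = 0`. -/
lemma rpow_le_of_forall_radius {a A d c₁ c₂ s n q : ℝ} (ha : 0 ≤ a) (hA : 0 < A) (hd : 0 ≤ d)
    (hc₁ : 0 ≤ c₁) (hc₂ : 0 ≤ c₂) (hs : 0 < s) (hn : 2 * s < n) (hq : q = 2 * n / (n - 2 * s))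
    (h : ∀ r : ℝ, 0 < r → a ≤ c₁ * r ^ s * d + c₂ * r ^ (-(n / q)) * A) :
    a ^ q ≤ (c₁ + c₂) ^ q * A ^ (q - 2) * d ^ (2 : ℝ) := by
  have hn0 : 0 < n := by linarith
  have hns : 0 < n - 2 * s := by linarith
  have hq0 : 0 < q := by rw [hq]; positivity
  have hnq : n / q = (n - 2 * s) / 2 := by rw [hq]; field_simp
  have h2q : 2 / q = 1 - 2 * s / n := by rw [hq]; field_simp
  rcases hd.eq_or_lt with rfl | hd0
  · have ht : Tendsto (fun r : ℝ => c₁ * r ^ s * 0 + c₂ * r ^ (-(n / q)) * A) atTop (𝓝 0) := by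
      have := ((tendsto_rpow_neg_atTop (y := n / q) (by positivity)).const_mul c₂).mul_const A
      simpa using this
    have : a ≤ 0 := ge_of_tendsto ht (by
      filter_upwards [eventually_gt_atTop 0] with r hr using h r hr)
    have : a = 0 := le_antisymm this ha
    rw [this, Real.zero_rpow hq0.ne', Real.zero_rpow two_ne_zero, mul_zero]
  -- At this radius both terms are multiples of `A^{1-2/q} d^{2/q}`.
  · have h1 := h ((A / d) ^ (2 / n)) (by positivity)
    have hAd : 0 < A / d := by positivity
    have e1 : ((A / d) ^ (2 / n)) ^ s * d = A ^ (1 - 2 / q) * d ^ (2 / q) := by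
      rw [← Real.rpow_mul hAd.le, Real.div_rpow hA.le hd0.le, h2q]
      have : 2 / n * s = 2 * s / n := by ring
      rw [this, Real.rpow_sub hd0, Real.rpow_one]
      have : (1 - (1 - 2 * s / n)) = 2 * s / n := by ring
      rw [this]
      ring
    have e2 : ((A / d) ^ (2 / n)) ^ (-(n / q)) * A = A ^ (1 - 2 / q) * d ^ (2 / q) := by
      rw [← Real.rpow_mul hAd.le]
      have : 2 / n * -(n / q) = -(2 / q) := by field_simp
      rw [this, Real.rpow_neg hAd.le, Real.div_rpow hA.le hd0.le, Real.rpow_sub hA, Real.rpow_one,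
        inv_div]
      ring
    rw [mul_assoc, mul_assoc, e1, e2, ← add_mul] at h1
    calc a ^ q ≤ ((c₁ + c₂) * (A ^ (1 - 2 / q) * d ^ (2 / q))) ^ q := by gcongr
      _ = (c₁ + c₂) ^ q * A ^ (q - 2) * d ^ (2 : ℝ) := by
        rw [Real.mul_rpow (by positivity) (by positivity),
          Real.mul_rpow (by positivity) (by positivity), ← Real.rpow_mul hA.le,
          ← Real.rpow_mul hd0.le, ← mul_assoc]
        congr 3 <;> field_simp

/-- The left side is the `L²` norm over the ball of the constant `u x = (u x - u y) + u y`. On the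
ball the first summand is at most `r^{(N+2s)/2}` times the difference quotient, and the second is
handled by Hölder. -/
lemma enorm_mul_rpow_ball_le {s q : ℝ} (hs : 0 < s) (hq : 2 ≤ q)
    {u : EuclideanSpace ℝ (Fin N) → ℝ} (hu : AEStronglyMeasurable u volume)
    (x : EuclideanSpace ℝ (Fin N)) (r : ℝ) :
    ‖u x‖ₑ * volume (Metric.ball x r) ^ (1 / 2 : ℝ) ≤
      ENNReal.ofReal (r ^ (((N : ℝ) + 2 * s) / 2)) *
          eLpNorm (fun y => diffQuot s u (x, y)) 2 volume +
        eLpNorm u (ENNReal.ofReal q) volume *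
          volume (Metric.ball x r) ^ (1 / 2 - 1 / q : ℝ) := by
  set μ := volume.restrict (Metric.ball x r) with hμ
  have huB : AEStronglyMeasurable u μ := hu.restrict
  have e0 : eLpNorm (fun _ => u x) 2 μ = ‖u x‖ₑ * volume (Metric.ball x r) ^ (1 / 2 : ℝ) := by
    rw [eLpNorm_const' _ two_ne_zero ENNReal.ofNat_ne_top, hμ, Measure.restrict_apply_univ]
    norm_num
  have e1 : eLpNorm (fun _ => u x) 2 μ ≤
      eLpNorm (fun y => u x - u y) 2 μ + eLpNorm u 2 μ := by
    have := eLpNorm_add_le (μ := μ) (p := 2) (f := fun y => u x - u y) (g := u)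
      (aestronglyMeasurable_const.sub huB) huB (by norm_num)
    refine le_trans (le_of_eq ?_) this
    congr 1
    funext y
    simp
  have e2 : eLpNorm (fun y => u x - u y) 2 μ ≤
      ENNReal.ofReal (r ^ (((N : ℝ) + 2 * s) / 2)) *
          eLpNorm (fun y => diffQuot s u (x, y)) 2 volume := by
    refine (eLpNorm_le_mul_eLpNorm_of_ae_le_mul (g := fun y => diffQuot s u (x, y))
      (c := r ^ (((N : ℝ) + 2 * s) / 2)) ?_ 2).trans ?_
    · filter_upwards [ae_restrict_mem Metric.isOpen_ball.measurableSet] with y hy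
      by_cases hxy : x = y
      · simp [hxy, diffQuot]
      have hpos : 0 < ‖x - y‖ := norm_pos_iff.2 (sub_ne_zero.2 hxy)
      have hlt : ‖x - y‖ ≤ r := by
        rw [← dist_eq_norm, dist_comm]
        exact (Metric.mem_ball.1 hy).le
      simp only [diffQuot, norm_div, Real.norm_eq_abs]
      rw [abs_of_pos (a := ‖x - y‖ ^ (((N : ℝ) + 2 * s) / 2)) (by positivity), ← mul_div_assoc,
        le_div_iff₀ (by positivity), mul_comm]
      gcongr
    · gcongr
      exact Measure.restrict_le_self
  have e3 : eLpNorm u 2 μ ≤ eLpNorm u (ENNReal.ofReal q) volume *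
          volume (Metric.ball x r) ^ (1 / 2 - 1 / q : ℝ) := by
    refine (eLpNorm_le_eLpNorm_mul_rpow_measure_univ (q := ENNReal.ofReal q) ?_ huB).trans ?_
    · rw [← ENNReal.ofReal_ofNat]
      exact ENNReal.ofReal_le_ofReal hq
    · rw [hμ, Measure.restrict_apply_univ, ENNReal.toReal_ofReal (by linarith)]
      simp only [ENNReal.toReal_ofNat]
      gcongr
      exact Measure.restrict_le_self
  rw [← e0]
  exact e1.trans (add_le_add e2 e3)

/-- The constant in the pointwise form of the Sobolev inequality. -/
def sobolevConst (N : ℕ) (s : ℝ) : ℝ :=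
  ((volume (Metric.ball (0 : EuclideanSpace ℝ (Fin N)) 1)).toReal ^ (-(1 / 2) : ℝ) +
    (volume (Metric.ball (0 : EuclideanSpace ℝ (Fin N)) 1)).toReal ^ (-(1 / sobolevExp N s)))

lemma sobolevConst_pos (N : ℕ) (s : ℝ) : 0 < sobolevConst N s := by
  have hV : 0 < (volume (Metric.ball (0 : EuclideanSpace ℝ (Fin N)) 1)).toReal :=
    ENNReal.toReal_pos (Metric.measure_ball_pos _ _ one_pos).ne' measure_ball_lt_top.ne
  unfold sobolevConst
  positivity

/-- Pointwise form of the Sobolev inequality. The ball has measure `r^N V`, so division by its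
square root leaves the powers `r^s` and `r^{-N/q}`, ready for `rpow_le_of_forall_radius`. -/
lemma enorm_rpow_le_of_bounded {s : ℝ} (hs : 0 < s) (hN : 2 * s < (N : ℝ))
    {u : EuclideanSpace ℝ (Fin N) → ℝ} (hu : MemLp u (ENNReal.ofReal (sobolevExp N s)) volume)
    (hu0 : eLpNorm u (ENNReal.ofReal (sobolevExp N s)) volume ≠ 0)
    {x : EuclideanSpace ℝ (Fin N)}
    (hx : eLpNorm (fun y => diffQuot s u (x, y)) 2 volume ≠ ⊤) :
    ‖u x‖ₑ ^ sobolevExp N s ≤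
      ENNReal.ofReal (sobolevConst N s ^ sobolevExp N s) *
        eLpNorm u (ENNReal.ofReal (sobolevExp N s)) volume ^ (sobolevExp N s - 2) *
        eLpNorm (fun y => diffQuot s u (x, y)) 2 volume ^ (2 : ℝ) := by
  set q := sobolevExp N s with hq
  have hq2 : 2 < q := two_lt_sobolevExp hs hN
  have hV : 0 < (volume (Metric.ball (0 : EuclideanSpace ℝ (Fin N)) 1)).toReal :=
    ENNReal.toReal_pos (Metric.measure_ball_pos _ _ one_pos).ne' measure_ball_lt_top.ne
  set V := (volume (Metric.ball (0 : EuclideanSpace ℝ (Fin N)) 1)).toReal with hVdef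
  set d := (eLpNorm (fun y => diffQuot s u (x, y)) 2 volume).toReal with hd
  set A := (eLpNorm u (ENNReal.ofReal q) volume).toReal with hA
  have hd' : eLpNorm (fun y => diffQuot s u (x, y)) 2 volume = ENNReal.ofReal d :=
    (ENNReal.ofReal_toReal hx).symm
  have hA' : eLpNorm u (ENNReal.ofReal q) volume = ENNReal.ofReal A :=
    (ENNReal.ofReal_toReal hu.2.ne).symm
  have hA0 : 0 < A := ENNReal.toReal_pos hu0 hu.2.ne
  have hd0 : 0 ≤ d := ENNReal.toReal_nonneg
  have key : ∀ r : ℝ, 0 < r →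
      |u x| ≤ V ^ (-(1 / 2) : ℝ) * r ^ s * d + V ^ (-(1 / q)) * r ^ (-((N : ℝ) / q)) * A := by
    intro r hr
    have h1 := enorm_mul_rpow_ball_le hs hq2.le hu.1 x r
    have hball : volume (Metric.ball x r) = ENNReal.ofReal (r ^ (N : ℝ) * V) := by
      have hne : Nonempty (Fin N) := Fin.pos_iff_nonempty.1 (by
        have : 0 < (N : ℝ) := by linarith
        exact_mod_cast this)
      rw [Measure.addHaar_ball _ _ hr.le, ENNReal.ofReal_mul (by positivity), hVdef,
        ENNReal.ofReal_toReal measure_ball_lt_top.ne]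
      simp
    have hrV : 0 < r ^ (N : ℝ) * V := by positivity
    rw [hball, hd', hA', Real.enorm_eq_ofReal_abs, ENNReal.ofReal_rpow_of_pos hrV,
      ENNReal.ofReal_rpow_of_pos hrV, ← ENNReal.ofReal_mul (abs_nonneg _),
      ← ENNReal.ofReal_mul (by positivity), ← ENNReal.ofReal_mul hA0.le,
      ← ENNReal.ofReal_add (by positivity) (by positivity),
      ENNReal.ofReal_le_ofReal_iff (by positivity), ← le_div_iff₀ (by positivity)] at h1
    refine h1.trans (le_of_eq ?_)
    rw [add_div]
    congr 1
    · rw [Real.mul_rpow (by positivity) hV.le, ← Real.rpow_mul hr.le, Real.rpow_neg hV.le]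
      have : ((N : ℝ) + 2 * s) / 2 = N * (1 / 2) + s := by ring
      rw [this, Real.rpow_add hr]
      field_simp
    · rw [Real.rpow_sub hrV, Real.rpow_neg hV.le, Real.rpow_neg hr.le,
        Real.mul_rpow (z := 1 / q) (by positivity) hV.le, ← Real.rpow_mul hr.le (N : ℝ) (1 / q)]
      have : (N : ℝ) * (1 / q) = N / q := by ring
      rw [this]
      field_simp
  have h2 := rpow_le_of_forall_radius (abs_nonneg _) hA0 hd0 (by positivity) (by positivity)
    hs hN hq key
  rw [hd', hA', Real.enorm_eq_ofReal_abs, ENNReal.ofReal_rpow_of_nonneg (abs_nonneg _)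
    (by linarith), ENNReal.ofReal_rpow_of_pos hA0, ENNReal.ofReal_rpow_of_nonneg hd0 two_pos.le,
    ← ENNReal.ofReal_mul (by have := sobolevConst_pos N s; positivity),
    ← ENNReal.ofReal_mul (by have := sobolevConst_pos N s; positivity)]
  exact ENNReal.ofReal_le_ofReal h2

lemma lintegral_eLpNorm_diffQuot {s : ℝ} {u : EuclideanSpace ℝ (Fin N) → ℝ}
    (hu : AEStronglyMeasurable u volume) :
    ∫⁻ x, eLpNorm (fun y => diffQuot s u (x, y)) 2 volume ^ (2 : ℝ) =
      eLpNorm (diffQuot s u) 2 (volume.prod volume) ^ (2 : ℝ) := by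
  have h : ∀ {α : Type} [MeasurableSpace α] (μ : Measure α) (f : α → ℝ),
      eLpNorm f 2 μ ^ (2 : ℝ) = ∫⁻ x, ‖f x‖ₑ ^ (2 : ℝ) ∂μ := by
    intro α _ μ f
    rw [eLpNorm_eq_lintegral_rpow_enorm_toReal two_ne_zero ENNReal.ofNat_ne_top,
      ← ENNReal.rpow_mul]
    simp
  simp_rw [h]
  rw [lintegral_prod]
  exact ((aestronglyMeasurable_diffQuot s hu).enorm).pow_const _

/-- Integrating the pointwise bound in `x` gives `A^q ≤ C A^{q-2} G²`, with `A` the `L^q` norm and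
`G` the seminorm. Cancelling `A^{q-2}` is legitimate only because `A` is assumed finite. -/
lemma eLpNorm_le_of_memLp_sobolevExp {s : ℝ} (hs : 0 < s) (hN : 2 * s < (N : ℝ))
    {u : EuclideanSpace ℝ (Fin N) → ℝ} (hu : MemFracSobolev s u)
    (huq : MemLp u (ENNReal.ofReal (sobolevExp N s)) volume) :
    eLpNorm u (ENNReal.ofReal (sobolevExp N s)) volume ≤
      ENNReal.ofReal (sobolevConst N s ^ (sobolevExp N s / 2) * Real.sqrt (gagliardoSq s u)) := by
  set q := sobolevExp N s with hq
  have hq2 : 2 < q := two_lt_sobolevExp hs hN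
  have hC := sobolevConst_pos N s
  by_cases hu0 : eLpNorm u (ENNReal.ofReal q) volume = 0
  · rw [hu0]
    exact zero_le
  have hfin : ∀ᵐ x, eLpNorm (fun y => diffQuot s u (x, y)) 2 volume ≠ ⊤ := by
    have hm : AEMeasurable
        (fun x => eLpNorm (fun y => diffQuot s u (x, y)) 2 volume ^ (2 : ℝ)) volume := by
      have : (fun x => eLpNorm (fun y => diffQuot s u (x, y)) 2 volume ^ (2 : ℝ)) =
          fun x => ∫⁻ y, ‖diffQuot s u (x, y)‖ₑ ^ (2 : ℝ) := by
        funext x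
        rw [eLpNorm_eq_lintegral_rpow_enorm_toReal two_ne_zero ENNReal.ofNat_ne_top,
          ← ENNReal.rpow_mul]
        simp
      rw [this]
      exact ((aestronglyMeasurable_diffQuot s hu.memLp.1).enorm.pow_const _).lintegral_prod_right'
    have := ae_lt_top' hm (by
      rw [lintegral_eLpNorm_diffQuot hu.memLp.1]
      exact ENNReal.rpow_ne_top_of_nonneg two_pos.le hu.memLp_diffQuot.2.ne)
    filter_upwards [this] with x hx hx'
    rw [hx'] at hx
    simp at hx
  have hint : eLpNorm u (ENNReal.ofReal q) volume ^ q ≤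
      ENNReal.ofReal (sobolevConst N s ^ q) *
        eLpNorm u (ENNReal.ofReal q) volume ^ (q - 2) *
        eLpNorm (diffQuot s u) 2 (volume.prod volume) ^ (2 : ℝ) := by
    rw [← lintegral_eLpNorm_diffQuot hu.memLp.1, ← lintegral_const_mul']
    · conv_lhs => rw [eLpNorm_eq_lintegral_rpow_enorm_toReal
        (by simpa using sobolevExp_pos hs hN) ENNReal.ofReal_ne_top,
        ENNReal.toReal_ofReal (by linarith), ← ENNReal.rpow_mul, one_div,
        inv_mul_cancel₀ (by linarith), ENNReal.rpow_one]
      refine lintegral_mono_ae ?_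
      filter_upwards [hfin] with x hx
      exact enorm_rpow_le_of_bounded hs hN huq hu0 hx
    · exact ENNReal.mul_ne_top ENNReal.ofReal_ne_top
        (ENNReal.rpow_ne_top_of_nonneg (by linarith) huq.2.ne)
  rw [eLpNorm_diffQuot hu] at hint
  set A := (eLpNorm u (ENNReal.ofReal q) volume).toReal with hA
  have hA' : eLpNorm u (ENNReal.ofReal q) volume = ENNReal.ofReal A :=
    (ENNReal.ofReal_toReal huq.2.ne).symm
  have hA0 : 0 < A := ENNReal.toReal_pos hu0 huq.2.ne
  set G := Real.sqrt (gagliardoSq s u) with hG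
  have hG0 : 0 ≤ G := Real.sqrt_nonneg _
  rw [hA', ENNReal.ofReal_rpow_of_pos hA0, ENNReal.ofReal_rpow_of_pos hA0,
    ENNReal.ofReal_rpow_of_nonneg hG0 two_pos.le, ← ENNReal.ofReal_mul (by positivity),
    ← ENNReal.ofReal_mul (by positivity), ENNReal.ofReal_le_ofReal_iff (by positivity)] at hint
  rw [hA']
  refine ENNReal.ofReal_le_ofReal ?_
  have e1 : A ^ q = A ^ (q - 2) * A ^ 2 := by
    rw [← Real.rpow_natCast, ← Real.rpow_add hA0]
    norm_num
  have e2 : (sobolevConst N s ^ (q / 2) * G) ^ 2 = sobolevConst N s ^ q * G ^ (2 : ℝ) := by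
    rw [mul_pow, ← Real.rpow_natCast (sobolevConst N s ^ (q / 2)), ← Real.rpow_mul hC.le]
    norm_num
  rw [e1, mul_right_comm, mul_comm _ (A ^ (q - 2)), ← e2] at hint
  have := le_of_mul_le_mul_left hint (by positivity)
  exact (pow_le_pow_iff_left₀ hA0.le (by positivity) two_ne_zero).1 this

/-- Pointwise, `|u|^q ≤ k^{q-p} |u|^p`. -/
lemma memLp_of_bounded_of_memLp {α : Type*} [MeasurableSpace α] {μ : Measure α} {u : α → ℝ}
    {p q : ℝ} (hp : 0 < p) (hpq : p ≤ q) (hu : MemLp u (ENNReal.ofReal p) μ) {k : ℝ}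
    (hk : ∀ x, |u x| ≤ k) : MemLp u (ENNReal.ofReal q) μ := by
  refine ⟨hu.1, ?_⟩
  have h1 := hu.2
  rw [eLpNorm_lt_top_iff_lintegral_rpow_enorm_lt_top (by simpa using hp) ENNReal.ofReal_ne_top,
    ENNReal.toReal_ofReal hp.le] at h1
  rw [eLpNorm_lt_top_iff_lintegral_rpow_enorm_lt_top (by simpa using hp.trans_le hpq)
    ENNReal.ofReal_ne_top, ENNReal.toReal_ofReal (hp.le.trans hpq)]
  refine lt_of_le_of_lt (lintegral_mono (g := fun x => ENNReal.ofReal k ^ (q - p) * ‖u x‖ₑ ^ p)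
    fun x => ?_) ?_
  · have : q = (q - p) + p := by ring
    conv_lhs => rw [this, ENNReal.rpow_add_of_nonneg _ _ (by linarith) hp.le]
    beta_reduce
    gcongr
    rw [Real.enorm_eq_ofReal_abs]
    exact ENNReal.ofReal_le_ofReal (hk x)
  · rw [lintegral_const_mul']
    · exact ENNReal.mul_lt_top (ENNReal.rpow_lt_top_of_nonneg (by linarith) ENNReal.ofReal_ne_top) h1
    · exact ENNReal.rpow_ne_top_of_nonneg (by linarith) ENNReal.ofReal_ne_top

/-- The fractional Sobolev inequality. -/
theorem eLpNorm_sobolevExp_le {s : ℝ} (hs : 0 < s) (hN : 2 * s < (N : ℝ))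
    {u : EuclideanSpace ℝ (Fin N) → ℝ} (hu : MemFracSobolev s u) :
    eLpNorm u (ENNReal.ofReal (sobolevExp N s)) volume ≤
      ENNReal.ofReal (sobolevConst N s ^ (sobolevExp N s / 2) * Real.sqrt (gagliardoSq s u)) := by
  have hC := sobolevConst_pos N s
  -- A truncation is bounded and in `L²`, hence in the critical space, so the conditional inequality
  -- applies to it; truncating does not increase the seminorm.
  refine eLpNorm_le_of_trunc hu.memLp.1 fun n => ?_
  have hn : MemFracSobolev s (trunc n ∘ u) :=
    hu.comp_lipschitz (lipschitzWith_trunc n) (trunc_zero n.cast_nonneg)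
  have hq2 := two_lt_sobolevExp hs hN
  refine (eLpNorm_le_of_memLp_sobolevExp hs hN hn ?_).trans ?_
  · refine memLp_of_bounded_of_memLp two_pos hq2.le ?_
      (k := n) fun x => abs_trunc_le n.cast_nonneg (u x)
    simpa using hn.memLp
  · refine ENNReal.ofReal_le_ofReal
      (mul_le_mul_of_nonneg_left (Real.sqrt_le_sqrt ?_) (by positivity))
    refine integral_mono hn.finite_seminorm hu.finite_seminorm fun z => ?_
    simp only [gagliardoKernel, Function.comp_apply]
    refine div_le_div_of_nonneg_right ?_ (by positivity)
    rw [← sq, ← sq]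
    refine sq_le_sq.2 ?_
    simpa [Real.dist_eq] using (lipschitzWith_trunc n).dist_le_mul (u z.1) (u z.2)

theorem MemFracSobolev.memLp_sobolevExp {s : ℝ} (hs : 0 < s) (hN : 2 * s < (N : ℝ))
    {u : EuclideanSpace ℝ (Fin N) → ℝ} (hu : MemFracSobolev s u) :
    MemLp u (ENNReal.ofReal (sobolevExp N s)) volume :=
  ⟨hu.memLp.1, (eLpNorm_sobolevExp_le hs hN hu).trans_lt ENNReal.ofReal_lt_top⟩

lemma gagliardoSq_eq_toReal_sq {s : ℝ} {u : EuclideanSpace ℝ (Fin N) → ℝ}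
    (hu : MemFracSobolev s u) :
    Real.sqrt (gagliardoSq s u) =
      (eLpNorm (diffQuot s u) 2 (volume.prod volume)).toReal := by
  rw [eLpNorm_diffQuot hu, ENNReal.toReal_ofReal (Real.sqrt_nonneg _)]

lemma ae_eq_zero_of_gagliardoSq_eq_zero {s : ℝ} (hs : 0 < s) (hN : 2 * s < (N : ℝ))
    {u : EuclideanSpace ℝ (Fin N) → ℝ} (hu : MemFracSobolev s u) (h : gagliardoSq s u = 0) :
    u =ᵐ[volume] 0 := by
  have h1 := eLpNorm_sobolevExp_le hs hN hu
  rw [h, Real.sqrt_zero, mul_zero, ENNReal.ofReal_zero, nonpos_iff_eq_zero] at h1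
  exact (eLpNorm_eq_zero_iff hu.memLp.1 (by simpa using sobolevExp_pos hs hN)).1 h1

/-- Makes functionals defined through the difference quotient independent of the chosen
representative. -/
lemma ae_eq_of_diffQuot_ae_eq {s : ℝ} (hs : 0 < s) (hN : 2 * s < (N : ℝ))
    {Ω : Set (EuclideanSpace ℝ (Fin N))} {u v : EuclideanSpace ℝ (Fin N) → ℝ}
    (hu : MemFracSobolevZero s Ω u) (hv : MemFracSobolevZero s Ω v)
    (h : diffQuot s u =ᵐ[volume.prod volume] diffQuot s v) : u =ᵐ[volume] v := by
  have h1 : gagliardoSq s (u - v) = 0 := by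
    refine integral_eq_zero_of_ae ?_
    filter_upwards [h] with z hz
    simp [gagliardoKernel_eq_mul_diffQuot, diffQuot_sub, hz]
  have h2 := ae_eq_zero_of_gagliardoSq_eq_zero hs hN (hu.sub hv).mem h1
  filter_upwards [h2] with x hx
  simpa [sub_eq_zero] using hx

/-! ### Pairing with data in the dual Sobolev exponent -/

/-- Hölder's inequality for the Bochner integral of a product of real functions. -/
lemma abs_integral_mul_le {α : Type*} [MeasurableSpace α] {μ : Measure α} {f g : α → ℝ}
    {p q : ℝ≥0∞} [p.HolderConjugate q] (hf : MemLp f p μ) (hg : MemLp g q μ) :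
    |∫ x, f x * g x ∂μ| ≤ (eLpNorm f p μ).toReal * (eLpNorm g q μ).toReal := by
  have h1 : eLpNorm (f • g) 1 μ ≤ eLpNorm f p μ * eLpNorm g q μ :=
    eLpNorm_smul_le_mul_eLpNorm hg.1 hf.1
  rw [← ENNReal.toReal_mul]
  refine le_trans ?_ (ENNReal.toReal_mono (ENNReal.mul_ne_top hf.2.ne hg.2.ne) h1)
  have h2 : Integrable (f • g) μ := MemLp.integrable_mul hf hg
  rw [← Real.norm_eq_abs]
  refine (norm_integral_le_integral_norm _).trans (le_of_eq ?_)
  rw [eLpNorm_one_eq_lintegral_enorm, ← integral_norm_eq_lintegral_enorm h2.1]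
  rfl

/-- The dual exponent `2N / (N + 2s)` of the critical Sobolev exponent. -/
def dualExp (N : ℕ) (s : ℝ) : ℝ := 2 * N / (N + 2 * s)

lemma holderConjugate_dualExp {s : ℝ} (hs : 0 < s) (hN : 2 * s < (N : ℝ)) :
    (dualExp N s).HolderConjugate (sobolevExp N s) := by
  have hN0 : 0 < (N : ℝ) := by linarith
  have h1 : 0 < (N : ℝ) - 2 * s := by linarith
  refine ⟨?_, ?_, sobolevExp_pos hs hN⟩
  · unfold dualExp sobolevExp
    field_simp
    ring
  · unfold dualExp
    positivity

lemma MemFracSobolevZero.integrableOn_mul {s : ℝ} (hs : 0 < s) (hN : 2 * s < (N : ℝ))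
    {Ω : Set (EuclideanSpace ℝ (Fin N))} {f v : EuclideanSpace ℝ (Fin N) → ℝ}
    (hf : MemLp f (ENNReal.ofReal (dualExp N s)) (volume.restrict Ω))
    (hv : MemFracSobolevZero s Ω v) : IntegrableOn (fun x => f x * v x) Ω volume := by
  have := (holderConjugate_dualExp hs hN).ennrealOfReal
  exact MemLp.integrable_mul hf ((hv.mem.memLp_sobolevExp hs hN).restrict Ω)

lemma abs_pairing_le {s : ℝ} (hs : 0 < s) (hN : 2 * s < (N : ℝ))
    {Ω : Set (EuclideanSpace ℝ (Fin N))} {f v : EuclideanSpace ℝ (Fin N) → ℝ}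
    (hf : MemLp f (ENNReal.ofReal (dualExp N s)) (volume.restrict Ω))
    (hv : MemFracSobolevZero s Ω v) :
    |∫ x in Ω, f x * v x| ≤
      (eLpNorm f (ENNReal.ofReal (dualExp N s)) (volume.restrict Ω)).toReal *
        sobolevConst N s ^ (sobolevExp N s / 2) * Real.sqrt (gagliardoSq s v) := by
  have := (holderConjugate_dualExp hs hN).ennrealOfReal
  have hC := sobolevConst_pos N s
  refine (abs_integral_mul_le hf ((hv.mem.memLp_sobolevExp hs hN).restrict Ω)).trans ?_
  rw [mul_assoc]
  refine mul_le_mul_of_nonneg_left ?_ ENNReal.toReal_nonneg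
  refine ENNReal.toReal_le_of_le_ofReal (by positivity) ?_
  exact (eLpNorm_mono_measure _ Measure.restrict_le_self).trans
    (eLpNorm_sobolevExp_le hs hN hv.mem)

lemma memDual_of_memLp {s : ℝ} (hs : 0 < s) (hN : 2 * s < (N : ℝ))
    {Ω : Set (EuclideanSpace ℝ (Fin N))} {f : EuclideanSpace ℝ (Fin N) → ℝ}
    (hf : MemLp f (ENNReal.ofReal (dualExp N s)) (volume.restrict Ω)) : MemDual s Ω f := by
  have hC := sobolevConst_pos N s
  refine ⟨(eLpNorm f (ENNReal.ofReal (dualExp N s)) (volume.restrict Ω)).toReal *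
    sobolevConst N s ^ (sobolevExp N s / 2),
    fun v hv => ⟨hv.integrableOn_mul hs hN hf, (abs_pairing_le hs hN hf hv).trans ?_⟩⟩
  refine mul_le_mul_of_nonneg_left ?_ (by positivity)
  refine Real.sqrt_le_sqrt ?_
  have : 0 ≤ ∫ x, v x ^ 2 := integral_nonneg fun x => sq_nonneg _
  unfold gagliardoSq
  linarith

/-! ### Existence and uniqueness of finite energy solutions -/

/-- The space of difference quotients of elements of `W_0^{s,2}(Ω̄)`, as a subspace of
`L²(ℝ^N × ℝ^N)`. -/
def diffQuotSpace (s : ℝ) (Ω : Set (EuclideanSpace ℝ (Fin N))) :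
    Submodule ℝ (Lp ℝ 2 ((volume : Measure (EuclideanSpace ℝ (Fin N))).prod
      (volume : Measure (EuclideanSpace ℝ (Fin N))))) where
  carrier := {G | ∃ u, MemFracSobolevZero s Ω u ∧ G =ᵐ[volume.prod volume] diffQuot s u}
  add_mem' := by
    rintro G H ⟨u, hu, hG⟩ ⟨v, hv, hH⟩
    refine ⟨u + v, hu.add hv, ?_⟩
    rw [diffQuot_add]
    exact (Lp.coeFn_add G H).trans (hG.add hH)
  zero_mem' := by
    refine ⟨0, .zero s Ω, ?_⟩
    exact Eventually.of_forall fun z => by simp [diffQuot]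
  smul_mem' := by
    rintro c G ⟨u, hu, hG⟩
    refine ⟨c • u, hu.smul c, ?_⟩
    rw [diffQuot_smul]
    exact (Lp.coeFn_smul c G).trans (hG.const_smul c)

lemma norm_eq_sqrt_gagliardoSq {s : ℝ} {u : EuclideanSpace ℝ (Fin N) → ℝ}
    (hu : MemFracSobolev s u)
    {G : Lp ℝ 2 ((volume : Measure (EuclideanSpace ℝ (Fin N))).prod
      (volume : Measure (EuclideanSpace ℝ (Fin N))))}
    (hG : G =ᵐ[volume.prod volume] diffQuot s u) : ‖G‖ = Real.sqrt (gagliardoSq s u) := by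
  rw [Lp.norm_def, eLpNorm_congr_ae hG, gagliardoSq_eq_toReal_sq hu]

/-- If difference quotients converge in `L²`, Sobolev makes the underlying functions Cauchy in the
critical space. Along a common subsequence both converge almost everywhere, which identifies the
limit as the difference quotient of the limit function. -/
lemma isClosed_diffQuotSpace {s : ℝ} (hs : 0 < s) (hN : 2 * s < (N : ℝ))
    {Ω : Set (EuclideanSpace ℝ (Fin N))} (hΩb : Bornology.IsBounded Ω) :
    IsClosed (diffQuotSpace s Ω : Set (Lp ℝ 2
      ((volume : Measure (EuclideanSpace ℝ (Fin N))).prod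
      (volume : Measure (EuclideanSpace ℝ (Fin N)))))) := by
  have hC := sobolevConst_pos N s
  have hq := two_lt_sobolevExp hs hN
  refine IsSeqClosed.isClosed fun G G₀ hG hlim => ?_
  choose u hu hGu using hG
  have : Fact (1 ≤ ENNReal.ofReal (sobolevExp N s)) :=
    ⟨by rw [← ENNReal.ofReal_one]; exact ENNReal.ofReal_le_ofReal (by linarith)⟩
  have huq : ∀ n, MemLp (u n) (ENNReal.ofReal (sobolevExp N s)) volume :=
    fun n => (hu n).mem.memLp_sobolevExp hs hN
  set K := sobolevConst N s ^ (sobolevExp N s / 2) with hK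
  have hK0 : 0 < K := by positivity
  have hdist : ∀ m n, dist ((huq m).toLp) ((huq n).toLp) ≤ K * dist (G m) (G n) := by
    intro m n
    rw [dist_eq_norm, dist_eq_norm, ← MemLp.toLp_sub, Lp.norm_toLp]
    have hd : (G m - G n : Lp ℝ 2 _) =ᵐ[volume.prod volume] diffQuot s (u m - u n) := by
      rw [diffQuot_sub]
      exact (Lp.coeFn_sub _ _).trans ((hGu m).sub (hGu n))
    rw [norm_eq_sqrt_gagliardoSq ((hu m).sub (hu n)).mem hd]
    exact ENNReal.toReal_le_of_le_ofReal (by positivity)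
      (eLpNorm_sobolevExp_le hs hN ((hu m).sub (hu n)).mem)
  have hcauchy : CauchySeq fun n => (huq n).toLp := by
    rw [Metric.cauchySeq_iff]
    intro ε hε
    obtain ⟨M, hM⟩ := Metric.cauchySeq_iff.1 hlim.cauchySeq (ε / K) (by positivity)
    refine ⟨M, fun m hm n hn => (hdist m n).trans_lt ?_⟩
    rw [← lt_div_iff₀' hK0]
    exact hM m hm n hn
  obtain ⟨U, hU⟩ := cauchySeq_tendsto_of_complete hcauchy
  obtain ⟨ns, hns, hns'⟩ := (tendstoInMeasure_of_tendsto_Lp hU).exists_seq_tendsto_ae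
  obtain ⟨ms, hms, hms'⟩ := (tendstoInMeasure_of_tendsto_Lp
    (hlim.comp hns.tendsto_atTop)).exists_seq_tendsto_ae
  have hae : ∀ᵐ x, Tendsto (fun i => u (ns (ms i)) x) atTop (𝓝 (U x)) := by
    have h1 : ∀ᵐ x, ∀ n, (huq n).toLp (u n) x = u n x :=
      ae_all_iff.2 fun n => (huq n).coeFn_toLp
    filter_upwards [hns', h1] with x hx hx1
    have := hx.comp hms.tendsto_atTop
    simpa [Function.comp_def, hx1] using this
  have hGU : G₀ =ᵐ[volume.prod volume] diffQuot s U := by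
    have h1 := (Measure.quasiMeasurePreserving_fst
      (μ := (volume : Measure (EuclideanSpace ℝ (Fin N))))
      (ν := (volume : Measure (EuclideanSpace ℝ (Fin N))))).ae hae
    have h2 := (Measure.quasiMeasurePreserving_snd
      (μ := (volume : Measure (EuclideanSpace ℝ (Fin N))))
      (ν := (volume : Measure (EuclideanSpace ℝ (Fin N))))).ae hae
    have h3 : ∀ᵐ z ∂((volume : Measure (EuclideanSpace ℝ (Fin N))).prod
      (volume : Measure (EuclideanSpace ℝ (Fin N)))), ∀ n, G n z = diffQuot s (u n) z :=
      ae_all_iff.2 hGu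
    filter_upwards [h1, h2, h3, hms'] with z hz1 hz2 hz3 hz4
    refine tendsto_nhds_unique hz4 ?_
    simp only [Function.comp_apply, hz3, diffQuot]
    exact (hz1.sub hz2).div_const _
  have hzero : ∀ᵐ x, x ∉ Ω → U x = 0 := by
    have h1 : ∀ᵐ x, ∀ n, x ∉ Ω → u n x = 0 := ae_all_iff.2 fun n => (hu n).zero_outside
    filter_upwards [hae, h1] with x hx hx1 hxΩ
    refine tendsto_nhds_unique hx ?_
    simp [hx1 _ hxΩ]
  have hU2 : MemLp U 2 volume := by
    -- The limit lies a priori only in the critical space. It vanishes off a set of finite measure,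
    -- so it is in `L²`; the measurable hull is used since `Ω` need not be measurable here.
    set T := toMeasurable volume Ω with hT
    have hTfin : volume T < ⊤ := by
      rw [hT, measure_toMeasurable]
      exact hΩb.measure_lt_top
    have : IsFiniteMeasure (volume.restrict T) := ⟨by simpa using hTfin⟩
    have h1 : MemLp U 2 (volume.restrict T) :=
      ((Lp.memLp U).restrict T).mono_exponent (by
        rw [← ENNReal.ofReal_ofNat]
        exact ENNReal.ofReal_le_ofReal hq.le)
    have h2 : T.indicator U =ᵐ[volume] U := by
      filter_upwards [hzero] with x hx
      by_cases hxT : x ∈ T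
      · simp [hxT]
      · rw [Set.indicator_of_notMem hxT, hx fun h => hxT (subset_toMeasurable _ _ h)]
    exact (memLp_congr_ae h2).1
      ((memLp_indicator_iff_restrict (measurableSet_toMeasurable _ _)).2 h1)
  exact ⟨U, ⟨.of_diffQuot hU2 ((memLp_congr_ae hGU).1 (Lp.memLp G₀)), hzero⟩, hGU⟩

lemma energyForm_self {s : ℝ} (u : EuclideanSpace ℝ (Fin N) → ℝ) :
    energyForm s u u = normConst N s / 2 * gagliardoSq s u := rfl

lemma energyForm_comm {s : ℝ} (u v : EuclideanSpace ℝ (Fin N) → ℝ) :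
    energyForm s u v = energyForm s v u := by
  unfold energyForm
  simp only [gagliardoKernel_eq_mul_diffQuot, mul_comm]

lemma energyForm_sub_left {s : ℝ} {u v w : EuclideanSpace ℝ (Fin N) → ℝ}
    (hu : MemFracSobolev s u) (hv : MemFracSobolev s v) (hw : MemFracSobolev s w) :
    energyForm s (u - v) w = energyForm s u w - energyForm s v w := by
  unfold energyForm
  rw [← mul_sub, ← integral_sub (hu.integrable_gagliardoKernel hw)
    (hv.integrable_gagliardoKernel hw)]
  congr 1
  refine integral_congr_ae (Eventually.of_forall fun z => ?_)
  simp only [gagliardoKernel_eq_mul_diffQuot, diffQuot_sub, Pi.sub_apply]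
  ring

/-- Testing both equations with the difference gives it zero energy. -/
lemma IsFiniteEnergySolution.ae_eq {s : ℝ} (hs0 : 0 < s) (hs1 : s < 1) (hN : 2 * s < (N : ℝ))
    {Ω : Set (EuclideanSpace ℝ (Fin N))} {f u v : EuclideanSpace ℝ (Fin N) → ℝ}
    (hu : IsFiniteEnergySolution s Ω f u) (hv : IsFiniteEnergySolution s Ω f v) :
    u =ᵐ[volume] v := by
  have hw := hu.mem.sub hv.mem
  have h1 : energyForm s (u - v) (u - v) = 0 := by
    rw [energyForm_sub_left hu.mem.mem hv.mem.mem hw.mem, hu.eq _ hw, hv.eq _ hw, sub_self]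
  rw [energyForm_self] at h1
  have hc := normConst_pos hs0 hs1 N
  have h2 : gagliardoSq s (u - v) = 0 := (mul_eq_zero.1 h1).resolve_left (by positivity)
  filter_upwards [ae_eq_zero_of_gagliardoSq_eq_zero hs0 hN hw.mem h2] with x hx
  simpa [sub_eq_zero] using hx

/-- Existence of finite energy solutions, by the Riesz representation theorem. -/
theorem exists_isFiniteEnergySolution {s : ℝ} (hs0 : 0 < s) (hs1 : s < 1)
    (hN : 2 * s < (N : ℝ)) {Ω : Set (EuclideanSpace ℝ (Fin N))} (hΩb : Bornology.IsBounded Ω)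
    {f : EuclideanSpace ℝ (Fin N) → ℝ}
    (hf : MemLp f (ENNReal.ofReal (dualExp N s)) (volume.restrict Ω)) :
    ∃ u, IsFiniteEnergySolution s Ω f u := by
  have hc := normConst_pos hs0 hs1 N
  have hrep : ∀ G : diffQuotSpace s Ω, ∃ u, MemFracSobolevZero s Ω u ∧
      G.1 =ᵐ[volume.prod volume] diffQuot s u := fun G => G.2
  choose R hR hGR using hrep
  have hpair : ∀ (G : diffQuotSpace s Ω) (v : EuclideanSpace ℝ (Fin N) → ℝ),
      MemFracSobolevZero s Ω v → G.1 =ᵐ[volume.prod volume] diffQuot s v →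
      ∫ x in Ω, f x * R G x = ∫ x in Ω, f x * v x := by
    intro G v hv hGv
    have h1 := ae_eq_of_diffQuot_ae_eq hs0 hN (hR G) hv ((hGR G).symm.trans hGv)
    refine integral_congr_ae ?_
    filter_upwards [ae_restrict_of_ae h1] with x hx
    rw [hx]
  let ℓ : diffQuotSpace s Ω →ₗ[ℝ] ℝ :=
    { toFun := fun G => ∫ x in Ω, f x * R G x
      map_add' := by
        intro G H
        rw [hpair (G + H) (R G + R H) ((hR G).add (hR H)) (by
          rw [diffQuot_add]
          exact (Lp.coeFn_add _ _).trans ((hGR G).add (hGR H))),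
          ← integral_add ((hR G).integrableOn_mul hs0 hN hf) ((hR H).integrableOn_mul hs0 hN hf)]
        simp only [Pi.add_apply, mul_add]
      map_smul' := by
        intro c G
        rw [hpair (c • G) (c • R G) ((hR G).smul c) (by
          rw [diffQuot_smul]
          exact (Lp.coeFn_smul _ _).trans ((hGR G).const_smul c)), RingHom.id_apply, smul_eq_mul,
          ← integral_const_mul]
        simp only [Pi.smul_apply, smul_eq_mul, mul_left_comm] }
  let L : StrongDual ℝ (diffQuotSpace s Ω) := ℓ.mkContinuous
    ((eLpNorm f (ENNReal.ofReal (dualExp N s)) (volume.restrict Ω)).toReal *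
        sobolevConst N s ^ (sobolevExp N s / 2)) fun G => by
      have h1 := abs_pairing_le hs0 hN hf (hR G)
      rw [← norm_eq_sqrt_gagliardoSq (hR G).mem (hGR G)] at h1
      exact h1
  have : CompleteSpace (diffQuotSpace s Ω) :=
    (isClosed_diffQuotSpace hs0 hN hΩb).completeSpace_coe
  -- The factor undoes the `C_{N,s}/2` by which the energy form differs from the inner product.
  set G₀ := (InnerProductSpace.toDual ℝ (diffQuotSpace s Ω)).symm ((2 / normConst N s) • L)
  refine ⟨R G₀, memDual_of_memLp hs0 hN hf, hR G₀, fun v hv => ?_⟩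
  obtain ⟨T, hT⟩ : ∃ T : Lp ℝ 2 ((volume : Measure (EuclideanSpace ℝ (Fin N))).prod
      (volume : Measure (EuclideanSpace ℝ (Fin N)))), T =ᵐ[volume.prod volume] diffQuot s v :=
    ⟨hv.mem.memLp_diffQuot.toLp (diffQuot s v), MemLp.coeFn_toLp _⟩
  let V : diffQuotSpace s Ω := ⟨T, v, hv, hT⟩
  have h1 : inner ℝ G₀ V = (2 / normConst N s) * ∫ x in Ω, f x * R V x :=
    InnerProductSpace.toDual_symm_apply
  rw [hpair V v hv hT] at h1
  have h2 : inner ℝ G₀ V = ∫ z, gagliardoKernel s (R G₀) v z ∂(volume.prod volume) := by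
    rw [Submodule.coe_inner, L2.inner_def]
    refine integral_congr_ae ?_
    filter_upwards [hGR G₀, hT] with z hz1 hz2
    rw [gagliardoKernel_eq_mul_diffQuot, hz1]
    change inner ℝ _ (T z) = _
    rw [hz2]
    simp [mul_comm]
  rw [energyForm, ← h2, h1]
  field_simp

/-! ### Odd powers and the inequalities that replace the chain rule -/

/-- The odd power function `t ↦ t |t|^{a-1}`. -/
def signedPow (a t : ℝ) : ℝ := t * |t| ^ (a - 1)

lemma signedPow_of_nonneg {a t : ℝ} (ha : 0 < a) (ht : 0 ≤ t) : signedPow a t = t ^ a := by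
  rcases ht.eq_or_lt with rfl | ht
  · simp [signedPow, Real.zero_rpow ha.ne']
  · rw [signedPow, abs_of_pos ht, Real.rpow_sub_one ht.ne']
    field_simp

lemma signedPow_neg (a t : ℝ) : signedPow a (-t) = -signedPow a t := by
  simp [signedPow]

lemma signedPow_zero (a : ℝ) : signedPow a 0 = 0 := by
  simp [signedPow]

lemma abs_signedPow {a : ℝ} (ha : 0 < a) (t : ℝ) : |signedPow a t| = |t| ^ a := by
  rw [← signedPow_of_nonneg ha (abs_nonneg t), signedPow, signedPow, abs_mul, abs_abs,
    abs_of_nonneg (a := |t| ^ (a - 1)) (by positivity)]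

/-- Bernoulli's inequality at `y / x`, multiplied by `x^a`. -/
lemma rpow_sub_rpow_le {a x y : ℝ} (ha : 1 ≤ a) (hy : 0 ≤ y) (hxy : y ≤ x) :
    x ^ a - y ^ a ≤ a * x ^ (a - 1) * (x - y) := by
  rcases (hy.trans hxy).eq_or_lt with rfl | hx
  · have : y = 0 := le_antisymm hxy hy
    simp [this]
  · have h := one_add_mul_self_le_rpow_one_add (s := y / x - 1) (by
      have : 0 ≤ y / x := by positivity
      linarith) ha
    have e : 1 + (y / x - 1) = y / x := by ring
    rw [e, Real.div_rpow hy hx.le, le_div_iff₀ (by positivity)] at h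
    have e2 : x ^ a = x ^ (a - 1) * x := by
      rw [Real.rpow_sub_one hx.ne']
      field_simp
    have e3 : (1 + a * (y / x - 1)) * x ^ a = x ^ a + a * x ^ (a - 1) * (y - x) := by
      rw [e2]
      field_simp
    rw [e3] at h
    linarith

/-- Stroock–Varopoulos inequality, with a constant that need not be sharp. For equal signs, bound
one factor of the square by Bernoulli and absorb `x^{γ-1}` into the other. For opposite signs, apply
Cauchy–Schwarz to `t^γ = t^{1/2} t^{γ-1/2}`. -/
lemma sq_signedPow_sub_le {γ : ℝ} (hγ : 1 ≤ γ) (x y : ℝ) :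
    (signedPow γ x - signedPow γ y) ^ 2 ≤
      γ * ((x - y) * (signedPow (2 * γ - 1) x - signedPow (2 * γ - 1) y)) := by
  have hγ0 : 0 < γ := by linarith
  have hδ0 : 0 < 2 * γ - 1 := by linarith
  have key1 : ∀ x y : ℝ, 0 ≤ y → y ≤ x → (signedPow γ x - signedPow γ y) ^ 2 ≤
      γ * ((x - y) * (signedPow (2 * γ - 1) x - signedPow (2 * γ - 1) y)) := by
    intro x y hy hxy
    have hx := hy.trans hxy
    rw [signedPow_of_nonneg hγ0 hx, signedPow_of_nonneg hγ0 hy, signedPow_of_nonneg hδ0 hx,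
      signedPow_of_nonneg hδ0 hy]
    have h1 := rpow_sub_rpow_le hγ hy hxy
    have h0 : 0 ≤ x ^ γ - y ^ γ := sub_nonneg.2 (Real.rpow_le_rpow hy hxy hγ0.le)
    have e : ∀ t : ℝ, 0 ≤ t → t ^ (2 * γ - 1) = t ^ (γ - 1) * t ^ γ := by
      intro t ht
      rw [← Real.rpow_add_of_nonneg ht (by linarith) hγ0.le]
      congr 1
      ring
    have h2 : x ^ (γ - 1) * (x ^ γ - y ^ γ) ≤ x ^ (2 * γ - 1) - y ^ (2 * γ - 1) := by
      rw [e x hx, e y hy]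
      have : y ^ (γ - 1) * y ^ γ ≤ x ^ (γ - 1) * y ^ γ := by
        gcongr
      linarith
    calc (x ^ γ - y ^ γ) ^ 2 = (x ^ γ - y ^ γ) * (x ^ γ - y ^ γ) := sq _
      _ ≤ (γ * x ^ (γ - 1) * (x - y)) * (x ^ γ - y ^ γ) := by gcongr
      _ = γ * ((x - y) * (x ^ (γ - 1) * (x ^ γ - y ^ γ))) := by ring
      _ ≤ _ := by
        have : 0 ≤ x - y := by linarith
        gcongr
  have key2 : ∀ x y : ℝ, 0 ≤ x → 0 ≤ y → (signedPow γ x + signedPow γ y) ^ 2 ≤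
      γ * ((x + y) * (signedPow (2 * γ - 1) x + signedPow (2 * γ - 1) y)) := by
    intro x y hx hy
    rw [signedPow_of_nonneg hγ0 hx, signedPow_of_nonneg hγ0 hy, signedPow_of_nonneg hδ0 hx,
      signedPow_of_nonneg hδ0 hy]
    have e : ∀ t : ℝ, 0 ≤ t →
        t = (t ^ (1 / 2 : ℝ)) ^ 2 ∧ t ^ (2 * γ - 1) = (t ^ (γ - 1 / 2)) ^ 2 ∧
          t ^ γ = t ^ (1 / 2 : ℝ) * t ^ (γ - 1 / 2) := by
      intro t ht
      refine ⟨?_, ?_, ?_⟩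
      · rw [← Real.rpow_natCast, ← Real.rpow_mul ht]
        norm_num
      · rw [← Real.rpow_natCast, ← Real.rpow_mul ht]
        congr 1
        push_cast
        ring
      · rw [← Real.rpow_add_of_nonneg ht (by norm_num) (by linarith)]
        congr 1
        ring
    obtain ⟨hx1, hx2, hx3⟩ := e x hx
    obtain ⟨hy1, hy2, hy3⟩ := e y hy
    have h1 : (x ^ γ + y ^ γ) ^ 2 ≤ (x + y) * (x ^ (2 * γ - 1) + y ^ (2 * γ - 1)) := by
      calc (x ^ γ + y ^ γ) ^ 2 = (x ^ (1 / 2 : ℝ) * x ^ (γ - 1 / 2) +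
            y ^ (1 / 2 : ℝ) * y ^ (γ - 1 / 2)) ^ 2 := by rw [hx3, hy3]
        _ ≤ ((x ^ (1 / 2 : ℝ)) ^ 2 + (y ^ (1 / 2 : ℝ)) ^ 2) *
            ((x ^ (γ - 1 / 2)) ^ 2 + (y ^ (γ - 1 / 2)) ^ 2) := by
          linarith [sq_nonneg (x ^ (1 / 2 : ℝ) * y ^ (γ - 1 / 2) -
            y ^ (1 / 2 : ℝ) * x ^ (γ - 1 / 2))]
        _ = _ := by rw [← hx1, ← hy1, hx2, hy2]
    refine h1.trans (le_mul_of_one_le_left ?_ hγ)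
    positivity
  have key : ∀ x y : ℝ, y ≤ x → (signedPow γ x - signedPow γ y) ^ 2 ≤
      γ * ((x - y) * (signedPow (2 * γ - 1) x - signedPow (2 * γ - 1) y)) := by
    intro x y hxy
    rcases le_total 0 y with hy | hy
    · exact key1 x y hy hxy
    · rcases le_total 0 x with hx | hx
      · have := key2 x (-y) hx (by linarith)
        simpa only [signedPow_neg, ← sub_eq_add_neg] using this
      · have := key1 (-y) (-x) (by linarith) (by linarith)
        simp only [signedPow_neg] at this
        refine (le_of_eq ?_).trans (this.trans (le_of_eq ?_)) <;> ring
  rcases le_total y x with h | h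
  · exact key x y h
  · refine (le_of_eq ?_).trans ((key y x h).trans (le_of_eq ?_)) <;> ring

lemma abs_signedPow_sub_le {a k x y : ℝ} (ha : 1 ≤ a) (hx : |x| ≤ k) (hy : |y| ≤ k) :
    |signedPow a x - signedPow a y| ≤ a * k ^ (a - 1) * |x - y| := by
  have ha0 : 0 < a := by linarith
  have key1 : ∀ x y : ℝ, 0 ≤ y → y ≤ x → x ≤ k →
      |signedPow a x - signedPow a y| ≤ a * k ^ (a - 1) * |x - y| := by
    intro x y hy hxy hxk
    have hx := hy.trans hxy
    rw [signedPow_of_nonneg ha0 hx, signedPow_of_nonneg ha0 hy,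
      abs_of_nonneg (sub_nonneg.2 (Real.rpow_le_rpow hy hxy ha0.le)),
      abs_of_nonneg (sub_nonneg.2 hxy)]
    refine (rpow_sub_rpow_le ha hy hxy).trans ?_
    have : 0 ≤ x - y := by linarith
    gcongr
  have key2 : ∀ x y : ℝ, 0 ≤ x → 0 ≤ y → x ≤ k → y ≤ k →
      |signedPow a x + signedPow a y| ≤ a * k ^ (a - 1) * |x + y| := by
    intro x y hx hy hxk hyk
    have h0 := key1 x 0 le_rfl hx hxk
    have h1 := key1 y 0 le_rfl hy hyk
    rw [signedPow_zero, sub_zero, sub_zero] at h0 h1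
    refine (abs_add_le _ _).trans ((add_le_add h0 h1).trans (le_of_eq ?_))
    rw [abs_of_nonneg hx, abs_of_nonneg hy, abs_of_nonneg (add_nonneg hx hy)]
    ring
  have key : ∀ x y : ℝ, y ≤ x → |x| ≤ k → |y| ≤ k →
      |signedPow a x - signedPow a y| ≤ a * k ^ (a - 1) * |x - y| := by
    intro x y hxy hxk hyk
    rw [abs_le] at hxk hyk
    rcases le_total 0 y with hy | hy
    · exact key1 x y hy hxy hxk.2
    · rcases le_total 0 x with hx | hx
      · have := key2 x (-y) hx (by linarith) hxk.2 (by linarith)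
        simpa only [signedPow_neg, ← sub_eq_add_neg] using this
      · have := key1 (-y) (-x) (by linarith) (by linarith) (by linarith)
        simp only [signedPow_neg] at this
        rwa [neg_sub_neg, neg_sub_neg] at this
  rcases le_total y x with h | h
  · exact key x y h hx hy
  · rw [abs_sub_comm, abs_sub_comm x]
    exact key y x h hy hx

lemma lipschitzWith_signedPow_trunc {a k : ℝ} (ha : 1 ≤ a) (hk : 0 ≤ k) :
    LipschitzWith (a * k ^ (a - 1)).toNNReal (signedPow a ∘ trunc k) := by
  refine LipschitzWith.of_dist_le' fun x y => ?_
  rw [Real.dist_eq, Real.dist_eq]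
  refine (abs_signedPow_sub_le ha (abs_trunc_le hk x) (abs_trunc_le hk y)).trans ?_
  have := (lipschitzWith_trunc k).dist_le_mul x y
  rw [Real.dist_eq, Real.dist_eq, NNReal.coe_one, one_mul] at this
  gcongr

/-- The power of the truncation differs in the same direction as its argument, so replacing the
difference of truncations by the larger `x - y` only increases the right side. -/
lemma sq_signedPow_trunc_sub_le {γ k : ℝ} (hγ : 1 ≤ γ) (x y : ℝ) :
    ((signedPow γ ∘ trunc k) x - (signedPow γ ∘ trunc k) y) ^ 2 ≤
      γ * ((x - y) * ((signedPow (2 * γ - 1) ∘ trunc k) x -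
        (signedPow (2 * γ - 1) ∘ trunc k) y)) := by
  have key : ∀ x y : ℝ, y ≤ x → (signedPow γ (trunc k x) - signedPow γ (trunc k y)) ^ 2 ≤
      γ * ((x - y) * (signedPow (2 * γ - 1) (trunc k x) -
        signedPow (2 * γ - 1) (trunc k y))) := by
    intro x y hxy
    have h := sq_signedPow_sub_le hγ (trunc k x) (trunc k y)
    rcases (monotone_trunc k hxy).eq_or_lt with he | hlt
    · simp [he]
    · refine h.trans ?_
      have h1 : 0 ≤ γ * ((trunc k x - trunc k y) * (signedPow (2 * γ - 1) (trunc k x) -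
        signedPow (2 * γ - 1) (trunc k y))) := (sq_nonneg _).trans h
      have h2 : 0 ≤ signedPow (2 * γ - 1) (trunc k x) - signedPow (2 * γ - 1) (trunc k y) :=
        nonneg_of_mul_nonneg_right (nonneg_of_mul_nonneg_right h1 (by linarith)) (by linarith)
      have h3 := (lipschitzWith_trunc k).dist_le_mul x y
      rw [Real.dist_eq, Real.dist_eq, NNReal.coe_one, one_mul, abs_of_pos (by linarith),
        abs_of_nonneg (by linarith)] at h3
      gcongr
  rcases le_total y x with h | h
  · exact key x y h
  · refine (le_of_eq ?_).trans ((key y x h).trans (le_of_eq ?_)) <;>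
      simp only [Function.comp_apply] <;> ring

/-! ### Testing with functions of the solution; the `L^q` estimate -/

/-- The constant in the energy estimate `‖Ψ(u)‖² ≤ C ∫_Ω f Φ(u)`. -/
def energyConst (N : ℕ) (s : ℝ) : ℝ :=
  (sobolevConst N s ^ (sobolevExp N s / 2)) ^ 2 * (2 / normConst N s)

lemma energyConst_pos {s : ℝ} (hs0 : 0 < s) (hs1 : s < 1) : 0 < energyConst N s := by
  have h1 := normConst_pos hs0 hs1 N
  have h2 := sobolevConst_pos N s
  unfold energyConst
  positivity

/-- Chain of three facts: Sobolev for `Ψ ∘ u`, the kernel comparison, and the equation tested with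
`Φ ∘ u`, which is admissible because `Φ` is Lipschitz with `Φ 0 = 0`. -/
lemma IsFiniteEnergySolution.sq_eLpNorm_comp_le {s κ : ℝ} (hs0 : 0 < s) (hs1 : s < 1)
    (hN : 2 * s < (N : ℝ)) {Ω : Set (EuclideanSpace ℝ (Fin N))}
    {f u : EuclideanSpace ℝ (Fin N) → ℝ} (hu : IsFiniteEnergySolution s Ω f u)
    {Φ Ψ : ℝ → ℝ} {K L : NNReal} (hΦ : LipschitzWith K Φ) (hΦ0 : Φ 0 = 0)
    (hΨ : LipschitzWith L Ψ) (hΨ0 : Ψ 0 = 0)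
    (h : ∀ a b, (Ψ a - Ψ b) ^ 2 ≤ κ * ((a - b) * (Φ a - Φ b))) :
    (eLpNorm (Ψ ∘ u) (ENNReal.ofReal (sobolevExp N s)) (volume.restrict Ω)).toReal ^ 2 ≤
      energyConst N s * (κ * ∫ x in Ω, f x * Φ (u x)) := by
  have hc := normConst_pos hs0 hs1 N
  have hC := sobolevConst_pos N s
  have hΨu := hu.mem.comp_lipschitz hΨ hΨ0
  have hΦu := hu.mem.comp_lipschitz hΦ hΦ0
  have h1 : (eLpNorm (Ψ ∘ u) (ENNReal.ofReal (sobolevExp N s)) (volume.restrict Ω)).toReal ≤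
      sobolevConst N s ^ (sobolevExp N s / 2) * Real.sqrt (gagliardoSq s (Ψ ∘ u)) :=
    ENNReal.toReal_le_of_le_ofReal (by positivity)
      ((eLpNorm_mono_measure _ Measure.restrict_le_self).trans
        (eLpNorm_sobolevExp_le hs0 hN hΨu.mem))
  have h2 := gagliardoSq_comp_le hu.mem.mem hΦ hΦ0 hΨ hΨ0 h
  have h3 := hu.eq _ hΦu
  rw [energyForm] at h3
  have h4 : ∫ z, gagliardoKernel s u (Φ ∘ u) z ∂(volume.prod volume) =
      2 / normConst N s * ∫ x in Ω, f x * Φ (u x) := by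
    simp only [Function.comp_apply] at h3
    rw [← h3]
    field_simp
  calc _ ≤ (sobolevConst N s ^ (sobolevExp N s / 2) *
        Real.sqrt (gagliardoSq s (Ψ ∘ u))) ^ 2 := by gcongr
    _ = (sobolevConst N s ^ (sobolevExp N s / 2)) ^ 2 * gagliardoSq s (Ψ ∘ u) := by
      rw [mul_pow, Real.sq_sqrt (gagliardoSq_nonneg _ _)]
    _ ≤ (sobolevConst N s ^ (sobolevExp N s / 2)) ^ 2 *
        (κ * (2 / normConst N s * ∫ x in Ω, f x * Φ (u x))) := by
      rw [← h4]
      gcongr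
    _ = _ := by
      rw [energyConst]
      ring

lemma eLpNorm_signedPow_comp {α : Type*} [MeasurableSpace α] {μ : Measure α} {a : ℝ} (ha : 0 < a)
    (w : α → ℝ) (p : ℝ≥0∞) :
    eLpNorm (signedPow a ∘ w) p μ = eLpNorm w (p * ENNReal.ofReal a) μ ^ a := by
  rw [← eLpNorm_norm_rpow _ ha]
  refine eLpNorm_congr_norm_ae (Eventually.of_forall fun x => ?_)
  simp only [Function.comp_apply, Real.norm_eq_abs]
  rw [abs_signedPow ha, abs_of_nonneg (a := |w x| ^ a) (by positivity)]

/-- `L^q` regularity up to the endpoint exponent `q = NP / (N - 2sP)`. -/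
theorem IsFiniteEnergySolution.eLpNorm_le {s : ℝ} (hs0 : 0 < s) (hs1 : s < 1)
    (hN : 2 * s < (N : ℝ)) {Ω : Set (EuclideanSpace ℝ (Fin N))} (hΩb : Bornology.IsBounded Ω)
    {P : ℝ} (hP : dualExp N s ≤ P) (hP' : P < N / (2 * s)) :
    ∃ C : ℝ, 0 < C ∧ ∀ f u : EuclideanSpace ℝ (Fin N) → ℝ,
      MemLp f (ENNReal.ofReal P) (volume.restrict Ω) → IsFiniteEnergySolution s Ω f u →
      eLpNorm u (ENNReal.ofReal (N * P / (N - 2 * s * P))) (volume.restrict Ω) ≤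
        ENNReal.ofReal C * eLpNorm f (ENNReal.ofReal P) (volume.restrict Ω) := by
  have hN0 : 0 < (N : ℝ) := by linarith
  have hd := holderConjugate_dualExp hs0 hN
  have hP1 : 1 < P := hd.lt.trans_le hP
  have hconj : P.HolderConjugate (P / (P - 1)) := Real.HolderConjugate.conjExponent hP1
  have hNP : 0 < N - 2 * s * P := by
    rw [lt_div_iff₀ (by positivity)] at hP'
    linarith
  have hPd : 2 * N ≤ P * (N + 2 * s) := by
    unfold dualExp at hP
    rwa [div_le_iff₀ (by positivity)] at hP
  -- This `γ` makes the exponent produced by Sobolev, `2Nγ/(N-2s)`, equal to the exponent required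
  -- by Hölder, `(2γ-1)P/(P-1)`; their common value is `R`. The condition `γ ≥ 1` is exactly `P ≥
  -- 2N/(N+2s)`.
  set γ : ℝ := P * (N - 2 * s) / (2 * (N - 2 * s * P)) with hγdef
  have hγ : 1 ≤ γ := by
    rw [hγdef, le_div_iff₀ (by positivity)]
    nlinarith
  have hγ0 : 0 < γ := by linarith
  have hNs : 0 < N - 2 * s := by linarith
  set R : ℝ := N * P / (N - 2 * s * P) with hR
  have hR0 : 0 < R := by positivity
  have e1 : sobolevExp N s * γ = R := by
    rw [hγdef, hR, sobolevExp]
    field_simp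
  have e2 : P / (P - 1) * (2 * γ - 1) = R := by
    have : P - 1 ≠ 0 := by linarith
    have e : 2 * γ - 1 = N * (P - 1) / (N - 2 * s * P) := by
      rw [eq_div_iff hNP.ne', sub_mul, hγdef, mul_assoc, div_mul_eq_mul_div, ← mul_div_assoc,
        mul_div_mul_left _ _ two_ne_zero, mul_div_cancel_right₀ _ hNP.ne']
      ring
    rw [e, hR]
    field_simp
  have hM := energyConst_pos (N := N) hs0 hs1
  refine ⟨energyConst N s * γ, by positivity, fun f u hf hu => ?_⟩
  have hfin : IsFiniteMeasure (volume.restrict Ω) := ⟨by simpa using hΩb.measure_lt_top⟩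
  -- Truncation makes the powers Lipschitz, hence admissible as test functions, and makes the `L^R`
  -- norm finite.
  refine eLpNorm_le_of_trunc hu.mem.mem.memLp.1.restrict fun n => ?_
  have hwm : AEStronglyMeasurable (trunc n ∘ u) (volume.restrict Ω) :=
    (lipschitzWith_trunc n).continuous.comp_aestronglyMeasurable hu.mem.mem.memLp.1.restrict
  have hw : ∀ r, MemLp (trunc n ∘ u) r (volume.restrict Ω) := fun r =>
    MemLp.of_bound hwm n (Eventually.of_forall fun x => abs_trunc_le n.cast_nonneg (u x))
  have hΦu : MemLp ((signedPow (2 * γ - 1) ∘ trunc n) ∘ u) (ENNReal.ofReal (P / (P - 1)))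
      (volume.restrict Ω) := by
    refine MemLp.of_bound ((lipschitzWith_signedPow_trunc (by linarith)
      n.cast_nonneg).continuous.comp_aestronglyMeasurable hu.mem.mem.memLp.1.restrict)
      ((n : ℝ) ^ (2 * γ - 1)) (Eventually.of_forall fun x => ?_)
    simp only [Function.comp_apply, Real.norm_eq_abs]
    rw [abs_signedPow (by linarith)]
    exact Real.rpow_le_rpow (abs_nonneg _) (abs_trunc_le n.cast_nonneg _) (by linarith)
  have h1 := hu.sq_eLpNorm_comp_le hs0 hs1 hN
    (lipschitzWith_signedPow_trunc (a := 2 * γ - 1) (by linarith) n.cast_nonneg)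
    (by simp [trunc_zero, signedPow_zero])
    (lipschitzWith_signedPow_trunc hγ n.cast_nonneg)
    (by simp [trunc_zero, signedPow_zero])
    (sq_signedPow_trunc_sub_le (k := n) hγ)
  have := hconj.ennrealOfReal
  have h2 := (le_abs_self _).trans (abs_integral_mul_le hf hΦu)
  rw [Function.comp_assoc, eLpNorm_signedPow_comp (by linarith),
    ← ENNReal.ofReal_mul (by have := hconj.symm.pos; positivity), e2] at h2
  rw [Function.comp_assoc, eLpNorm_signedPow_comp hγ0, ← ENNReal.ofReal_mul
    (sobolevExp_pos hs0 hN).le, e1, ← ENNReal.toReal_rpow] at h1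
  rw [← ENNReal.toReal_rpow] at h2
  set Y := (eLpNorm (trunc n ∘ u) (ENNReal.ofReal R) (volume.restrict Ω)).toReal with hY
  set F := (eLpNorm f (ENNReal.ofReal P) (volume.restrict Ω)).toReal with hF
  have hY0 : 0 ≤ Y := ENNReal.toReal_nonneg
  have hF0 : 0 ≤ F := ENNReal.toReal_nonneg
  -- The energy estimate reads `Y^{2γ} ≤ C γ F Y^{2γ-1}`; divide by `Y^{2γ-1}`.
  have h3 : Y ≤ energyConst N s * γ * F := by
    rcases hY0.eq_or_lt with h0 | h0
    · rw [← h0]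
      positivity
    · have h4 : (Y ^ γ) ^ 2 ≤ energyConst N s * (γ * (F * Y ^ (2 * γ - 1))) :=
        h1.trans (by gcongr; exact h2)
      have e3 : (Y ^ γ) ^ 2 = Y * Y ^ (2 * γ - 1) := by
        rw [← Real.rpow_natCast, ← Real.rpow_mul h0.le, ← Real.rpow_one_add' h0.le]
        · congr 1
          push_cast
          ring
        · linarith
      rw [e3] at h4
      refine le_of_mul_le_mul_right (h4.trans (le_of_eq ?_))
        (show 0 < Y ^ (2 * γ - 1) by positivity)
      ring
  rw [← ENNReal.ofReal_toReal (hw (ENNReal.ofReal R)).2.ne, ← ENNReal.ofReal_toReal hf.2.ne,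
    ← ENNReal.ofReal_mul (by positivity)]
  exact ENNReal.ofReal_le_ofReal h3

/-! ### Level sets and boundedness -/

/-- Stampacchia's lemma: decay of level sets with a superlinear exponent forces extinction at a
finite level, proportional to the constant `D` of the decay estimate. -/
lemma eq_zero_of_level_decay {m : ℝ → ℝ} {q θ V D : ℝ} (hq : 0 < q) (hθ : 1 < θ * q)
    (hV : 0 < V) (hD : 0 < D) (hm : ∀ k, 0 ≤ m k) (hanti : Antitone m) (hmV : m 0 ≤ V)
    (h : ∀ k, 0 ≤ k → ∀ l, k < l → (l - k) * m l ^ (1 / q) ≤ D * m k ^ θ) :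
    m (D * (V ^ (θ - 1 / q) * 2 ^ (1 + 1 / (θ * q - 1)))) = 0 := by
  set b := θ * q - 1 with hb
  have hb0 : 0 < b := by linarith
  set K := D * (V ^ (θ - 1 / q) * 2 ^ (1 + 1 / b)) with hK
  have hK0 : 0 < K := by positivity
  have hθ0 : 0 < θ := by
    by_contra hcon
    nlinarith
  -- Iterate along levels increasing to `K`, with gaps halving at each step. Geometric decay at rate
  -- `2^{-q/b}` is what the superlinear recursion can sustain.
  have hlev : ∀ n : ℕ, m (K * (1 - 2 ^ (-(n : ℝ)))) ≤ V * 2 ^ (-(q / b) * n) := by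
    intro n
    induction n with
    | zero => simpa using hmV
    | succ n ih =>
      have hdiff : K * (1 - 2 ^ (-((n + 1 : ℕ) : ℝ))) - K * (1 - 2 ^ (-(n : ℝ))) =
          K * 2 ^ (-((n : ℝ) + 1)) := by
        have : (2 : ℝ) ^ (-(n : ℝ)) = 2 * 2 ^ (-((n : ℝ) + 1)) := by
          have e : -(n : ℝ) = 1 + -((n : ℝ) + 1) := by ring
          rw [e, Real.rpow_add two_pos, Real.rpow_one]
        rw [this]
        push_cast
        ring
      have hk : 0 ≤ K * (1 - 2 ^ (-(n : ℝ))) := by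
        have : (2 : ℝ) ^ (-(n : ℝ)) ≤ 1 :=
          Real.rpow_le_one_of_one_le_of_nonpos one_le_two (by simp)
        exact mul_nonneg hK0.le (by linarith)
      have h1 := h _ hk (K * (1 - 2 ^ (-((n + 1 : ℕ) : ℝ)))) (by
        rw [← sub_pos, hdiff]
        positivity)
      rw [hdiff] at h1
      have h2 : D * m (K * (1 - 2 ^ (-(n : ℝ)))) ^ θ ≤ D * (V * 2 ^ (-(q / b) * n)) ^ θ := by
        gcongr
        exact hm _
      -- This identity determines `K`: with that choice the recursion reproduces the geometric bound
      -- exactly.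
      have h3 : D * (V * 2 ^ (-(q / b) * n)) ^ θ =
          K * 2 ^ (-((n : ℝ) + 1)) * (V * 2 ^ (-(q / b) * (n + 1 : ℕ))) ^ (1 / q) := by
        rw [Real.mul_rpow hV.le (by positivity), Real.mul_rpow hV.le (by positivity),
          ← Real.rpow_mul two_pos.le, ← Real.rpow_mul two_pos.le, hK]
        have e1 : V ^ θ = V ^ (θ - 1 / q) * V ^ (1 / q) := by
          rw [← Real.rpow_add hV]
          congr 1
          ring
        have e2 : (2 : ℝ) ^ (-(q / b) * n * θ) = 2 ^ (1 + 1 / b) * 2 ^ (-((n : ℝ) + 1)) *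
            2 ^ (-(q / b) * (n + 1 : ℕ) * (1 / q)) := by
          rw [← Real.rpow_add two_pos, ← Real.rpow_add two_pos]
          congr 1
          push_cast
          have : θ * q = b + 1 := by rw [hb]; ring
          field_simp
          linear_combination (-(n : ℝ)) * this
        rw [e1, e2]
        ring
      have h4 := le_of_mul_le_mul_left (h1.trans (h2.trans_eq h3)) (by positivity)
      exact (Real.rpow_le_rpow_iff (hm _) (by positivity) (by positivity)).1 h4
  refine le_antisymm ?_ (hm _)
  have hlim : Tendsto (fun n : ℕ => V * (2 : ℝ) ^ (-(q / b) * n)) atTop (𝓝 0) := by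
    have h1 : (2 : ℝ) ^ (-(q / b)) < 1 :=
      Real.rpow_lt_one_of_one_lt_of_neg one_lt_two (by have := div_pos hq hb0; linarith)
    have h2 := (tendsto_pow_atTop_nhds_zero_of_lt_one (by positivity) h1).const_mul V
    rw [mul_zero] at h2
    refine h2.congr fun n => ?_
    rw [Real.rpow_mul two_pos.le, Real.rpow_natCast]
  refine ge_of_tendsto' hlim fun n => le_trans (hanti ?_) (hlev n)
  have : (0 : ℝ) < 2 ^ (-(n : ℝ)) := by positivity
  nlinarith

/-- Both truncation and its complement `t - trunc k t` are nondecreasing, so an increment of the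
complement is at most that of `t`. -/
lemma sq_sub_trunc_sub_le {k : ℝ} (x y : ℝ) :
    ((x - trunc k x) - (y - trunc k y)) ^ 2 ≤
      1 * ((x - y) * ((x - trunc k x) - (y - trunc k y))) := by
  have key : ∀ x y : ℝ, y ≤ x → ((x - trunc k x) - (y - trunc k y)) ^ 2 ≤
      (x - y) * ((x - trunc k x) - (y - trunc k y)) := by
    intro x y hxy
    have h1 := monotone_trunc k hxy
    have h3 := (lipschitzWith_trunc k).dist_le_mul x y
    rw [Real.dist_eq, Real.dist_eq, NNReal.coe_one, one_mul, abs_of_nonneg (by linarith),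
      abs_of_nonneg (by linarith)] at h3
    nlinarith
  rw [one_mul]
  rcases le_total y x with h | h
  · exact key x y h
  · refine (le_of_eq ?_).trans ((key y x h).trans (le_of_eq ?_)) <;> ring

lemma lipschitzWith_sub_trunc (k : ℝ) : LipschitzWith 2 (fun t => t - trunc k t) := by
  have := (LipschitzWith.id (α := ℝ)).sub (lipschitzWith_trunc k)
  rwa [one_add_one_eq_two] at this

lemma sub_le_abs_sub_trunc {k l t : ℝ} (hk : 0 ≤ k) (ht : l < |t|) : l - k ≤ |t - trunc k t| := by
  have h1 := abs_sub_abs_le_abs_sub t (trunc k t)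
  have h2 := abs_trunc_le hk t
  linarith

/-- Boundedness of finite energy solutions for data in `L^P`, `P > N / (2s)`. -/
theorem IsFiniteEnergySolution.eLpNorm_top_le {s : ℝ} (hs0 : 0 < s) (hs1 : s < 1)
    (hN : 2 * s < (N : ℝ)) {Ω : Set (EuclideanSpace ℝ (Fin N))} (hΩb : Bornology.IsBounded Ω)
    {P : ℝ} (hP : N / (2 * s) < P) :
    ∃ C : ℝ, 0 < C ∧ ∀ f u : EuclideanSpace ℝ (Fin N) → ℝ,
      MemLp f (ENNReal.ofReal P) (volume.restrict Ω) → IsFiniteEnergySolution s Ω f u →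
      eLpNorm u ⊤ (volume.restrict Ω) ≤
        ENNReal.ofReal C * eLpNorm f (ENNReal.ofReal P) (volume.restrict Ω) := by
  have hN0 : 0 < (N : ℝ) := by linarith
  have hNP : N < P * (2 * s) := by rwa [div_lt_iff₀ (by positivity)] at hP
  have hP1 : 1 < P := lt_of_le_of_lt ((one_le_div (by positivity)).2 hN.le) hP
  have hconj : P.HolderConjugate (P / (P - 1)) := Real.HolderConjugate.conjExponent hP1
  have hfin : IsFiniteMeasure (volume.restrict Ω) := ⟨by simpa using hΩb.measure_lt_top⟩
  set μ := volume.restrict Ω with hμ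
  set q := sobolevExp N s with hqdef
  have hq0 : 0 < q := sobolevExp_pos hs0 hN
  have hq2 : 2 < q := two_lt_sobolevExp hs0 hN
  have hNs : 0 < N - 2 * s := by linarith
  set P' := P / (P - 1) with hP'
  have hP'0 : 0 < P' := hconj.symm.pos
  -- The gain from Hölder on a level set. The superlinearity `θ q > 1` needed by Stampacchia is
  -- equivalent to `P > N/(2s)`.
  set θ := 1 / P' - 1 / q with hθdef
  have hθq : 1 < θ * q := by
    have hP'2 : q / P' = 2 * N * (P - 1) / ((N - 2 * s) * P) := by
      have : P - 1 ≠ 0 := by linarith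
      rw [hqdef, hP', sobolevExp]
      field_simp
    have h1 : 2 < q / P' := by
      rw [hP'2, lt_div_iff₀ (by positivity)]
      nlinarith
    have h2 : θ * q = q / P' - 1 := by
      rw [hθdef]
      field_simp
    linarith
  have hP'q : P' ≤ q := by
    have : 0 < θ := by
      by_contra hcon
      nlinarith
    rw [hθdef, sub_pos] at this
    exact ((one_div_lt_one_div hq0 hP'0).1 this).le
  have hM := energyConst_pos (N := N) hs0 hs1
  -- Adding `1` keeps `V` positive when `Ω` is null.
  set V := (μ Set.univ).toReal + 1 with hV
  have hV0 : 0 < V := by positivity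
  set B := V ^ (θ - 1 / q) * 2 ^ (1 + 1 / (θ * q - 1)) with hB
  have hB0 : 0 < B := by positivity
  refine ⟨energyConst N s * B, by positivity, fun f u hf hu => ?_⟩
  set F := (eLpNorm f (ENNReal.ofReal P) μ).toReal with hF
  have hF0 : 0 ≤ F := ENNReal.toReal_nonneg
  have hum : AEStronglyMeasurable u μ := hu.mem.mem.memLp.1.restrict
  set m : ℝ → ℝ := fun k => (μ {x | k < |u x|}).toReal with hm
  have hdecay : ∀ k, 0 ≤ k → ∀ l, k < l →
      (l - k) * m l ^ (1 / q) ≤ energyConst N s * F * m k ^ θ := by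
    intro k hk l hkl
    set w : EuclideanSpace ℝ (Fin N) → ℝ := (fun t => t - trunc k t) ∘ u with hw
    have hwW := hu.mem.comp_lipschitz (lipschitzWith_sub_trunc k) (by simp [trunc_zero hk])
    have hwq : MemLp w (ENNReal.ofReal q) μ := (hwW.mem.memLp_sobolevExp hs0 hN).restrict Ω
    have hwP : MemLp w (ENNReal.ofReal P') μ :=
      hwq.mono_exponent (ENNReal.ofReal_le_ofReal hP'q)
    have h1 := hu.sq_eLpNorm_comp_le hs0 hs1 hN (lipschitzWith_sub_trunc k)
      (by simp [trunc_zero hk]) (lipschitzWith_sub_trunc k) (by simp [trunc_zero hk])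
      sq_sub_trunc_sub_le
    have := hconj.ennrealOfReal
    have h2 := (le_abs_self _).trans (abs_integral_mul_le hf hwP)
    set X := (eLpNorm w (ENNReal.ofReal q) μ).toReal with hX
    have hX0 : 0 ≤ X := ENNReal.toReal_nonneg
    -- The excess `w` vanishes off `{k < |u|}`, so Hölder on that set gains a power of its measure.
    -- The set is replaced by its measurable hull, which has the same measure.
    have h3 : (eLpNorm w (ENNReal.ofReal P') μ).toReal ≤ X * m k ^ θ := by
      set A := toMeasurable μ {x | k < |u x|} with hA
      have hsupp : Function.support w ⊆ A := by
        intro x hx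
        refine subset_toMeasurable _ _ ?_
        by_contra hcon
        exact hx (by
          simp only [hw, Function.comp_apply]
          rw [trunc_eq_self (not_lt.1 hcon), sub_self])
      have h4 := eLpNorm_le_eLpNorm_mul_rpow_measure_univ (μ := μ.restrict A)
        (ENNReal.ofReal_le_ofReal hP'q) hwq.1.restrict
      rw [eLpNorm_restrict_eq_of_support_subset hsupp, eLpNorm_restrict_eq_of_support_subset hsupp,
        Measure.restrict_apply_univ, hA, measure_toMeasurable, ENNReal.toReal_ofReal hP'0.le,
        ENNReal.toReal_ofReal hq0.le] at h4
      have h5 := ENNReal.toReal_mono (ENNReal.mul_ne_top hwq.2.ne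
        (ENNReal.rpow_ne_top_of_nonneg (by
          have := one_div_le_one_div_of_le hP'0 hP'q
          linarith) (measure_ne_top μ _))) h4
      rwa [ENNReal.toReal_mul, ← ENNReal.toReal_rpow] at h5
    have h4 : X ≤ energyConst N s * F * m k ^ θ := by
      have hmk : 0 ≤ m k ^ θ := Real.rpow_nonneg ENNReal.toReal_nonneg _
      rcases hX0.eq_or_lt with h0 | h0
      · rw [← h0]
        positivity
      · have h5 : X * X ≤ X * (energyConst N s * F * m k ^ θ) := by
          calc X * X = X ^ 2 := (sq X).symm
            _ ≤ energyConst N s * (1 * (F * (X * m k ^ θ))) := by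
              refine h1.trans ?_
              gcongr
              exact h2.trans (by gcongr)
            _ = _ := by ring
        exact le_of_mul_le_mul_left h5 h0
    refine le_trans ?_ h4
    -- Chebyshev: on `{l < |u|}` the excess over level `k` is at least `l - k`.
    have h5 := mul_meas_ge_le_pow_eLpNorm' μ (by simpa using hq0 : ENNReal.ofReal q ≠ 0)
      ENNReal.ofReal_ne_top hwq.1 (ENNReal.ofReal (l - k))
    rw [ENNReal.toReal_ofReal hq0.le] at h5
    have h6 : ENNReal.ofReal (l - k) ^ q * μ {x | l < |u x|} ≤
        eLpNorm w (ENNReal.ofReal q) μ ^ q := by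
      refine le_trans ?_ h5
      gcongr
      intro hx
      rw [Real.enorm_eq_ofReal_abs]
      exact ENNReal.ofReal_le_ofReal (sub_le_abs_sub_trunc hk hx)
    have h7 := ENNReal.toReal_mono (ENNReal.rpow_ne_top_of_nonneg hq0.le hwq.2.ne) h6
    rw [ENNReal.toReal_mul, ← ENNReal.toReal_rpow, ← ENNReal.toReal_rpow,
      ENNReal.toReal_ofReal (by linarith)] at h7
    have hml : 0 ≤ m l := ENNReal.toReal_nonneg
    have hlk : 0 ≤ l - k := by linarith
    refine (Real.rpow_le_rpow_iff (by positivity) hX0 hq0).1 ?_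
    rwa [Real.mul_rpow hlk (by positivity), ← Real.rpow_mul hml, one_div,
      inv_mul_cancel₀ hq0.ne', Real.rpow_one]
  -- Stampacchia's lemma needs a positive decay constant, but the norm of `f` may be zero; hence the
  -- `ε`, sent to zero afterwards.
  have hbound : ∀ ε : ℝ, 0 < ε →
      eLpNorm u ⊤ μ ≤ ENNReal.ofReal ((energyConst N s * F + ε) * B) := by
    intro ε hε
    have h1 : m ((energyConst N s * F + ε) * B) = 0 := by
      refine eq_zero_of_level_decay hq0 hθq hV0 (by positivity) (fun k => ENNReal.toReal_nonneg)
        ?_ ?_ ?_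
      · intro k l hkl
        refine ENNReal.toReal_mono (measure_ne_top _ _) (measure_mono ?_)
        exact fun x hx => lt_of_le_of_lt hkl hx
      · have : m 0 ≤ (μ Set.univ).toReal :=
          ENNReal.toReal_mono (measure_ne_top _ _) (measure_mono (Set.subset_univ _))
        linarith
      · intro k hk l hkl
        refine (hdecay k hk l hkl).trans ?_
        have hmk : 0 ≤ m k ^ θ := Real.rpow_nonneg ENNReal.toReal_nonneg _
        nlinarith
    have h2 : μ {x | (energyConst N s * F + ε) * B < |u x|} = 0 :=
      ((ENNReal.toReal_eq_zero_iff _).1 h1).resolve_right (measure_ne_top _ _)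
    rw [eLpNorm_exponent_top]
    refine eLpNormEssSup_le_of_ae_bound ?_
    rw [ae_iff]
    simpa using h2
  have hlim : Tendsto (fun ε : ℝ => ENNReal.ofReal ((energyConst N s * F + ε) * B)) (𝓝[>] 0)
      (𝓝 (ENNReal.ofReal ((energyConst N s * F + 0) * B))) := by
    refine ENNReal.tendsto_ofReal (Tendsto.mono_left ?_ nhdsWithin_le_nhds)
    exact (Continuous.tendsto (by fun_prop) 0)
  have hle := ge_of_tendsto hlim (by
    filter_upwards [self_mem_nhdsWithin] with ε hε using hbound ε hε)
  refine hle.trans (le_of_eq ?_)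
  rw [← ENNReal.ofReal_toReal hf.2.ne, ← ENNReal.ofReal_mul (by positivity)]
  congr 1
  rw [add_zero]
  ring

/-! ### Duality solutions and transfer of the estimates -/

/-- On a finite measure space, the inclusion `L^q ⊆ L^p`, `0 < p ≤ q`, is bounded. -/
lemma exists_eLpNorm_le_mul_eLpNorm {α : Type*} [MeasurableSpace α] (μ : Measure α)
    [IsFiniteMeasure μ] {p q : ℝ≥0∞} (hp : p ≠ 0) (hpq : p ≤ q) :
    ∃ C : ℝ, 0 < C ∧ ∀ f : α → ℝ, AEStronglyMeasurable f μ →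
      eLpNorm f p μ ≤ ENNReal.ofReal C * eLpNorm f q μ := by
  have hexp : 0 ≤ 1 / p.toReal - 1 / q.toReal := by
    rcases eq_or_ne q ⊤ with rfl | hq
    · simp
    · have hp' : 0 < p.toReal := ENNReal.toReal_pos hp (hpq.trans_lt hq.lt_top).ne
      exact sub_nonneg.2 (one_div_le_one_div_of_le hp' (ENNReal.toReal_mono hq hpq))
  have hfin : μ Set.univ ^ (1 / p.toReal - 1 / q.toReal) ≠ ⊤ :=
    ENNReal.rpow_ne_top_of_nonneg hexp (measure_ne_top _ _)
  refine ⟨(μ Set.univ ^ (1 / p.toReal - 1 / q.toReal)).toReal + 1, by positivity,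
    fun f hf => ?_⟩
  refine (eLpNorm_le_eLpNorm_mul_rpow_measure_univ hpq hf).trans ?_
  rw [mul_comm]
  gcongr
  rw [← ENNReal.ofReal_toReal hfin]
  exact ENNReal.ofReal_le_ofReal (by simp)

/-- By symmetry of the energy, `∫_Ω f φ = E(u, φ) = E(φ, u) = ∫_Ω ψ u`; integrability of `f φ` is
part of `f` lying in the dual space. -/
lemma IsFiniteEnergySolution.isDualitySolution {s : ℝ} {Ω : Set (EuclideanSpace ℝ (Fin N))}
    (hΩb : Bornology.IsBounded Ω) {f u : EuclideanSpace ℝ (Fin N) → ℝ}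
    (hf : IntegrableOn f Ω volume) (hu : IsFiniteEnergySolution s Ω f u) :
    IsDualitySolution s Ω f u := by
  have hfin : IsFiniteMeasure (volume.restrict Ω) := ⟨by simpa using hΩb.measure_lt_top⟩
  obtain ⟨K, hK⟩ := hu.datum_mem
  refine ⟨(hu.mem.mem.memLp.restrict Ω).integrable one_le_two, hf, fun φ ψ _ hφ =>
    ⟨(hK φ hφ.mem).1, ?_⟩⟩
  rw [← hu.eq φ hφ.mem, energyForm_comm, hφ.eq u hu.mem]
  simp only [mul_comm]

/-- Every test function `ψ` is the datum of some finite energy solution `φ`, so `∫_Ω (u - v) ψ = 0`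
for all `ψ`, and the fundamental lemma of the calculus of variations applies. -/
lemma IsDualitySolution.ae_eq {s : ℝ} (hs0 : 0 < s) (hs1 : s < 1)
    (hN : 2 * s < (N : ℝ)) {Ω : Set (EuclideanSpace ℝ (Fin N))} (hΩ : IsOpen Ω)
    (hΩb : Bornology.IsBounded Ω) {f u v : EuclideanSpace ℝ (Fin N) → ℝ}
    (hu : IsDualitySolution s Ω f u) (hv : IsDualitySolution s Ω f v) :
    u =ᵐ[volume.restrict Ω] v := by
  have h := hΩ.ae_eq_zero_of_integral_contDiff_smul_eq_zero (μ := volume)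
    (hu.integrable.sub hv.integrable).locallyIntegrableOn fun ψ hψ hψc hψs => by
      obtain ⟨φ, hφ⟩ := exists_isFiniteEnergySolution hs0 hs1 hN hΩb
        ((hψ.continuous.memLp_of_hasCompactSupport hψc
          (p := ENNReal.ofReal (dualExp N s)) (μ := volume)).restrict Ω)
      have h1 := (hu.eq φ ψ ⟨hψ, hψc, hψs⟩ hφ).2.trans (hv.eq φ ψ ⟨hψ, hψc, hψs⟩ hφ).2.symm
      obtain ⟨K, hK⟩ := hψ.continuous.bounded_above_of_compact_support hψc
      have hint : ∀ w : EuclideanSpace ℝ (Fin N) → ℝ, IntegrableOn w Ω volume →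
          IntegrableOn (fun x => w x * ψ x) Ω volume := fun w hw =>
        hw.mul_bdd hψ.continuous.aestronglyMeasurable (Eventually.of_forall hK)
      rw [← setIntegral_eq_integral_of_forall_compl_eq_zero (s := Ω)]
      · have : ∀ x, ψ x • (u - v) x = u x * ψ x - v x * ψ x := fun x => by
          simp only [Pi.sub_apply, smul_eq_mul]
          ring
        simp only [this]
        rw [integral_sub (hint u hu.integrable) (hint v hv.integrable), h1, sub_self]
      · intro x hx
        rw [image_eq_zero_of_notMem_tsupport fun h => hx (hψs h), zero_smul]
  rw [Filter.EventuallyEq, ae_restrict_iff' hΩ.measurableSet]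
  filter_upwards [h] with x hx hxΩ
  simpa [sub_eq_zero] using hx hxΩ

/-- Existence and uniqueness of finite energy and of duality solutions, which coincide. -/
theorem exists_unique_weakSolution {s : ℝ} (hs0 : 0 < s) (hs1 : s < 1)
    (hN : 2 * s < (N : ℝ)) {Ω : Set (EuclideanSpace ℝ (Fin N))} (hΩ : IsOpen Ω)
    (hΩb : Bornology.IsBounded Ω) {p : ℝ≥0∞} (hp : ENNReal.ofReal (dualExp N s) ≤ p)
    {f : EuclideanSpace ℝ (Fin N) → ℝ} (hf : MemLp f p (volume.restrict Ω)) :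
    ∃ u : EuclideanSpace ℝ (Fin N) → ℝ,
      IsFiniteEnergySolution s Ω f u ∧ IsDualitySolution s Ω f u ∧
      (∀ v, IsFiniteEnergySolution s Ω f v → v =ᵐ[volume] u) ∧
      (∀ v, IsDualitySolution s Ω f v → v =ᵐ[volume.restrict Ω] u) := by
  have hfin : IsFiniteMeasure (volume.restrict Ω) := ⟨by simpa using hΩb.measure_lt_top⟩
  have hf' := hf.mono_exponent hp
  have h1 : 1 ≤ ENNReal.ofReal (dualExp N s) := by
    rw [← ENNReal.ofReal_one]
    exact ENNReal.ofReal_le_ofReal (holderConjugate_dualExp hs0 hN).lt.le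
  obtain ⟨u, hu⟩ := exists_isFiniteEnergySolution hs0 hs1 hN hΩb hf'
  have hud := hu.isDualitySolution hΩb (hf'.integrable h1)
  exact ⟨u, hu, hud, fun v hv => hv.ae_eq hs0 hs1 hN hu,
    fun v hv => hv.ae_eq hs0 hs1 hN hΩ hΩb hud⟩

/-- A priori estimates for finite energy solutions, with data and solution in possibly weaker
spaces, hold for both notions of solution. -/
lemma exists_eLpNorm_weakSolution_le {s : ℝ} (hs0 : 0 < s) (hs1 : s < 1)
    (hN : 2 * s < (N : ℝ)) {Ω : Set (EuclideanSpace ℝ (Fin N))} (hΩ : IsOpen Ω)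
    (hΩb : Bornology.IsBounded Ω) {p p₁ q q₁ : ℝ≥0∞} (hp : ENNReal.ofReal (dualExp N s) ≤ p)
    (hp₁ : p₁ ≠ 0) (hp₁p : p₁ ≤ p) (hq : q ≠ 0) (hqq₁ : q ≤ q₁)
    (h : ∃ C : ℝ, 0 < C ∧ ∀ f u : EuclideanSpace ℝ (Fin N) → ℝ,
      MemLp f p₁ (volume.restrict Ω) → IsFiniteEnergySolution s Ω f u →
      eLpNorm u q₁ (volume.restrict Ω) ≤ ENNReal.ofReal C * eLpNorm f p₁ (volume.restrict Ω)) :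
    ∃ C : ℝ, 0 < C ∧ ∀ f u : EuclideanSpace ℝ (Fin N) → ℝ,
      MemLp f p (volume.restrict Ω) →
      (IsFiniteEnergySolution s Ω f u ∨ IsDualitySolution s Ω f u) →
      MemLp u q (volume.restrict Ω) ∧
        eLpNorm u q (volume.restrict Ω) ≤
          ENNReal.ofReal C * eLpNorm f p (volume.restrict Ω) := by
  have hfin : IsFiniteMeasure (volume.restrict Ω) := ⟨by simpa using hΩb.measure_lt_top⟩
  obtain ⟨C, hC0, hC⟩ := h
  obtain ⟨D, hD0, hD⟩ := exists_eLpNorm_le_mul_eLpNorm (volume.restrict Ω) hp₁ hp₁p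
  obtain ⟨B, hB0, hB⟩ := exists_eLpNorm_le_mul_eLpNorm (volume.restrict Ω) hq hqq₁
  have key : ∀ f u : EuclideanSpace ℝ (Fin N) → ℝ,
      MemLp f p (volume.restrict Ω) → IsFiniteEnergySolution s Ω f u →
      MemLp u q (volume.restrict Ω) ∧
        eLpNorm u q (volume.restrict Ω) ≤
          ENNReal.ofReal (B * (C * D)) * eLpNorm f p (volume.restrict Ω) := by
    intro f u hf hu
    have hum : AEStronglyMeasurable u (volume.restrict Ω) := hu.mem.mem.memLp.1.restrict
    have hle : eLpNorm u q (volume.restrict Ω) ≤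
        ENNReal.ofReal (B * (C * D)) * eLpNorm f p (volume.restrict Ω) := by
      rw [ENNReal.ofReal_mul hB0.le, ENNReal.ofReal_mul hC0.le, mul_assoc, mul_assoc]
      refine (hB u hum).trans ?_
      gcongr
      refine (hC f u (hf.mono_exponent hp₁p) hu).trans ?_
      gcongr
      exact hD f hf.1
    exact ⟨⟨hum, hle.trans_lt (ENNReal.mul_lt_top ENNReal.ofReal_lt_top hf.2)⟩, hle⟩
  refine ⟨B * (C * D), by positivity, fun f u hf hu => ?_⟩
  -- A solution of either kind agrees on `Ω` with the finite energy solution `w`, so it is enough to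
  -- estimate `w`.
  obtain ⟨w, hw, -, hw1, hw2⟩ := exists_unique_weakSolution hs0 hs1 hN hΩ hΩb hp hf
  have hae : u =ᵐ[volume.restrict Ω] w :=
    hu.elim (fun h => ae_restrict_of_ae (hw1 u h)) (hw2 u)
  rw [memLp_congr_ae hae, eLpNorm_congr_ae hae]
  exact key f w hf hw

end FracDirichlet

end

/-! ### The theorem -/

open FracDirichlet
theorem lemma2p3 (N : ℕ) (s : ℝ) (hs0 : 0 < s) (hs1 : s < 1) (hN : 2 * s < (N : ℝ))
    (Ω : Set (EuclideanSpace ℝ (Fin N))) (hΩ : IsOpen Ω) (hΩb : Bornology.IsBounded Ω)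
    (p : ℝ≥0∞) (hp : ENNReal.ofReal (2 * N / (N + 2 * s)) ≤ p) :
    -- existence and uniqueness, for both notions of weak solution, which moreover agree
    (∀ f : EuclideanSpace ℝ (Fin N) → ℝ, MemLp f p (volume.restrict Ω) →
      ∃ u : EuclideanSpace ℝ (Fin N) → ℝ,
        IsFiniteEnergySolution s Ω f u ∧ IsDualitySolution s Ω f u ∧
        (∀ v, IsFiniteEnergySolution s Ω f v → v =ᵐ[volume] u) ∧
        (∀ v, IsDualitySolution s Ω f v → v =ᵐ[volume.restrict Ω] u)) ∧
    -- boundedness for `p > N / (2 s)`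
    (ENNReal.ofReal (N / (2 * s)) < p →
      ∃ C : ℝ, 0 < C ∧ ∀ f u : EuclideanSpace ℝ (Fin N) → ℝ,
        MemLp f p (volume.restrict Ω) →
        (IsFiniteEnergySolution s Ω f u ∨ IsDualitySolution s Ω f u) →
        MemLp u ∞ (volume.restrict Ω) ∧
          eLpNorm u ∞ (volume.restrict Ω) ≤
            ENNReal.ofReal C * eLpNorm f p (volume.restrict Ω)) ∧
    -- `L^q` regularity for `p ≤ N / (2 s)`
    (p ≤ ENNReal.ofReal (N / (2 * s)) →
      ∀ q : ℝ≥0∞, p ≤ q → q < limitExponent N s p →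
      ∃ C : ℝ, 0 < C ∧ ∀ f u : EuclideanSpace ℝ (Fin N) → ℝ,
        MemLp f p (volume.restrict Ω) →
        (IsFiniteEnergySolution s Ω f u ∨ IsDualitySolution s Ω f u) →
        MemLp u q (volume.restrict Ω) ∧
          eLpNorm u q (volume.restrict Ω) ≤
            ENNReal.ofReal C * eLpNorm f p (volume.restrict Ω)) := by
  have hN0 : 0 < (N : ℝ) := by linarith
  have hd1 : 1 < dualExp N s := (holderConjugate_dualExp hs0 hN).lt
  have hp0 : p ≠ 0 := by
    refine ne_of_gt (lt_of_lt_of_le ?_ hp)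
    exact ENNReal.ofReal_pos.2 (zero_lt_one.trans hd1)
  refine ⟨fun f hf => exists_unique_weakSolution hs0 hs1 hN hΩ hΩb hp hf, fun hlt => ?_,
    fun hle q hpq hq => ?_⟩
  -- Since `p` may be `∞`, a finite exponent `r` above `N/(2s)` is used instead.
  · obtain ⟨r, hr1, hr2⟩ := exists_between hlt
    have hr : ENNReal.ofReal r.toReal = r := ENNReal.ofReal_toReal (hr2.trans_le le_top).ne
    have hrP : N / (2 * s) < r.toReal := by
      rw [← hr] at hr1
      exact (ENNReal.ofReal_lt_ofReal_iff_of_nonneg (by positivity)).1 hr1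
    exact exists_eLpNorm_weakSolution_le hs0 hs1 hN hΩ hΩb hp (bot_lt_of_lt hr1).ne'
      hr2.le (by simp) le_rfl
      (by simpa only [hr] using IsFiniteEnergySolution.eLpNorm_top_le hs0 hs1 hN hΩb hrP)
  · have hptop : p ≠ ⊤ := (hle.trans_lt ENNReal.ofReal_lt_top).ne
    have hP : ENNReal.ofReal p.toReal = p := ENNReal.ofReal_toReal hptop
    have hq0 : q ≠ 0 := (hp0.bot_lt.trans_le hpq).ne'
    rw [limitExponent] at hq
    split_ifs at hq with hlt
    · have hPlt : p.toReal < N / (2 * s) := by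
        rw [← hP] at hlt
        exact (ENNReal.ofReal_lt_ofReal_iff_of_nonneg ENNReal.toReal_nonneg).1 hlt
      have hPd : dualExp N s ≤ p.toReal := by
        rw [← hP] at hp
        exact (ENNReal.ofReal_le_ofReal_iff ENNReal.toReal_nonneg).1 hp
      exact exists_eLpNorm_weakSolution_le hs0 hs1 hN hΩ hΩb hp hp0 le_rfl hq0 hq.le
        (by simpa only [hP] using IsFiniteEnergySolution.eLpNorm_le hs0 hs1 hN hΩb hPd hPlt)
    · have hpeq : p = ENNReal.ofReal (N / (2 * s)) := le_antisymm hle (not_lt.1 hlt)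
      have hNs : 0 < N - 2 * s := by linarith
      -- At `p = N/(2s)` the datum is demoted to a smaller exponent `P` solving `NP/(N-2sP) = Q`.
      -- Taking `Q` at least the critical Sobolev exponent ensures `P ≥ 2N/(N+2s)`.
      set Q := max q.toReal (sobolevExp N s) with hQ
      have hQ0 : 0 < Q := (sobolevExp_pos hs0 hN).trans_le (le_max_right _ _)
      set P := N * Q / (N + 2 * s * Q) with hPdef
      have hPlt : P < N / (2 * s) := by
        rw [hPdef, div_lt_div_iff₀ (by positivity) (by positivity)]
        nlinarith
      have hPd : dualExp N s ≤ P := by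
        have h1 : 2 * N ≤ Q * (N - 2 * s) := by
          have := le_max_right q.toReal (sobolevExp N s)
          rwa [← hQ, sobolevExp, div_le_iff₀ hNs] at this
        rw [hPdef, dualExp, div_le_div_iff₀ (by positivity) (by positivity)]
        nlinarith
      have hQP : N * P / (N - 2 * s * P) = Q := by
        have h1 : N - 2 * s * P = N * N / (N + 2 * s * Q) := by
          rw [hPdef]
          field_simp
          ring
        rw [h1, hPdef]
        field_simp
      refine exists_eLpNorm_weakSolution_le hs0 hs1 hN hΩ hΩb hp (p₁ := ENNReal.ofReal P)
        (by simpa using (zero_lt_one.trans hd1).trans_le hPd) ?_ hq0 (q₁ := ENNReal.ofReal Q) ?_ ?_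
      · rw [hpeq]
        exact ENNReal.ofReal_le_ofReal hPlt.le
      · rw [← ENNReal.ofReal_toReal hq.ne]
        exact ENNReal.ofReal_le_ofReal (le_max_left _ _)
      · have := IsFiniteEnergySolution.eLpNorm_le hs0 hs1 hN hΩb hPd hPlt
        rwa [hQP] at this
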